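/- All graphs are finite, undirected, loopless multigraphs with distinct vertex labels and distinct edge labels from a fixed countable set (say $\mathbb N$). A plane embedded graph is such a graph together with a circular order of the incident edges around each vertex that is planar, i.e. every connected component satisfies Euler's formula. For a graph $G$ let $\mathrm{Emb}(G)$ be the set of its plane embeddings; $G$ is planar if $\mathrm{Emb}(G)\neq\emptyset$. A flip of a plane embedded graph keeps the graph and takes a subgraph that is separated from the rest of the graph by one vertex (articulation flip) or by two vertices (separation flip), and that occupies an interval of the circular order around each separating vertex; it either reflects this subgraph in place (the intervals, and the circular orders around its other vertices, are reversed) or slides it (the intervals are moved, unreversed, to new positions in the circular orders around the separating vertices), the result being again a plane embedded graph. The flip-graph has all plane embedded graphs as vertices; two of them are adjacent if one arises from the other by deleting one edge, or by one flip. Let $\operatorname{dist}(H,H')$ be the length of a shortest path in the flip-graph (with value $\infty$ if there is none), and for sets $A,B$ of plane embedded graphs let $$\operatorname{dist}(A,B)=\max\Bigl\{\sup_{a\in A}\inf_{b\in B}\operatorname{dist}(a,b),\ \sup_{b\in B}\inf_{a\in A}\operatorname{dist}(a,b)\Bigr\}$$ be their Hausdorff distance. **Theorem (Lower bound 1).**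 For every $n\ge 1$ there exist a planar graph $G$ with $O(n)$ vertices and an edge $e\in G$ such that $\operatorname{dist}(\mathrm{Emb}(G-e),\mathrm{Emb}(G))\in\Omega(n)$, where the implied constants are absolute. Moreover, the following two families are such examples, again with absolute implied constants. 1. For $n\ge 5$, the wheel graph $W_n$ on $n$ vertices (a hub joined to all vertices of a cycle on $n-1$ vertices) is planar, and $\operatorname{dist}(\mathrm{Emb}(W_n-e),\mathrm{Emb}(W_n))\in\Omega(n)$ for every edge $e$ of the outer rim (the cycle). 2. For $k\ge 3$, let $G_k$ be obtained from the circular ladder $CL_k$ with $2k$ vertices by contracting two consecutive rungs and removing one of the two edges that have become parallel; let $e$ be the other one. Then $G_k$ is planar and cubic, has $n=2k-2$ vertices, and $\operatorname{dist}(\mathrm{Emb}(G_k-e),\mathrm{Emb}(G_k))\in\Omega(n)$. -/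

import Mathlib

/-! ### Plane embedded multigraphs

A combinatorial embedding of a multigraph is given by a circular order of the edges around every
vertex.  An edge `e` seen from its end `v` is the *dart* `(v, e)`, and the circular orders are packed
into one permutation of the darts, which sends `(v, e)` to `(v, e')` with `e'` the next edge
around `v`. -/

/-- The darts of a multigraph (for loopless graphs: every edge has exactly two). -/
def Graph.darts {α β : Type*} (G : Graph α β) : Set (α × β) :=
  {d | G.Inc d.2 d.1}

/-- The number of connected components of a multigraph. -/
noncomputable def Graph.numComponents {α β : Type*} (G : Graph α β) : ℕ :=
  Nat.card (Quot fun u v : G.vertexSet => G.Adj u.1 v.1)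

/-- The number of faces (facial walks) of the embedding of `G` given by `rot`.  From the dart
`(u, e)`, a facial walk crosses `e = uw` and continues with the dart following `(w, e)` around `w`;
the classes generated by this step are the facial walks of positive length.  An isolated vertex is
a facial walk of length zero. -/
noncomputable def Graph.numFaces {α β : Type*} (G : Graph α β) (rot : Equiv.Perm (α × β)) : ℕ :=
  Nat.card (Quot fun d d' : G.darts => ∃ w, G.IsLink d.1.2 d.1.1 w ∧ d'.1 = rot (w, d.1.2)) +
    {v | v ∈ G.vertexSet ∧ ∀ e, ¬ G.Inc e v}.ncard

/-- A plane embedded graph: a finite loopless multigraph together with a circular order of the edges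
around every vertex, satisfying Euler's formula.  (Facial walks are counted for every component
separately, so that the formula says that every component is embedded with genus zero.) -/
structure PlaneGraph (α β : Type*) where
  graph : Graph α β
  finite_vertexSet : graph.vertexSet.Finite
  finite_edgeSet : graph.edgeSet.Finite
  loopless : graph.Loopless
  rot : Equiv.Perm (α × β)
  /-- Pairs that are not darts carry no information. -/
  rot_of_not_inc : ∀ d, d ∉ graph.darts → rot d = d
  /-- The darts at each vertex are permuted cyclically. -/
  rot_isCycleOn : ∀ v, rot.IsCycleOn {d | d ∈ graph.darts ∧ d.1 = v}
  euler : graph.vertexSet.ncard + graph.numFaces rot =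
    graph.edgeSet.ncard + 2 * graph.numComponents

/-- `Emb(G)`: the set of all plane embeddings of `G`. -/
def Emb {α β : Type*} (G : Graph α β) : Set (PlaneGraph α β) :=
  {H | H.graph = G}

/-- A multigraph is planar if it has a plane embedding. -/
def Graph.IsPlanar {α β : Type*} (G : Graph α β) : Prop :=
  (Emb G).Nonempty

namespace PlaneGraph

/-- `H' = H - e`: the edge `e` is deleted, and skipped in the circular orders. -/
def IsDeletion {α β : Type*} (H : PlaneGraph α β) (e : β) (H' : PlaneGraph α β) : Prop :=
  e ∈ H.graph.edgeSet ∧ H'.graph = H.graph.deleteEdges {e} ∧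
    ∀ d : α × β, d.2 ≠ e →
      ((H.rot d).2 ≠ e → H'.rot d = H.rot d) ∧
      ((H.rot d).2 = e → H'.rot d = H.rot (H.rot d))

/-- The circular order of the edges around `v` in `H` is `l` (read cyclically). -/
def HasOrder {α β : Type*} [DecidableEq β] (H : PlaneGraph α β) (v : α) (l : List β) : Prop :=
  l.Nodup ∧ (∀ e, e ∈ l ↔ H.graph.Inc e v) ∧ ∀ e ∈ l, H.rot (v, e) = (v, l.formPerm e)

/-- The subgraph formed by the edges in `S` is separated from the rest of the graph by the vertices
in `X`: each vertex of `X` lies both on an edge in `S` and on an edge outside `S`, and no other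
vertex does. -/
def IsSeparatedBy {α β : Type*} (G : Graph α β) (S : Set β) (X : Set α) : Prop :=
  ∀ v, v ∈ X ↔ (∃ e ∈ S, G.Inc e v) ∧ ∃ e ∉ S, G.Inc e v

/-- `H'` arises from `H` by reflecting the subgraph with edge set `S`, which is separated from the
rest by `X` and occupies an interval `s` of the circular order around each vertex of `X`: this
interval is reversed in place, and the circular orders around the other vertices of the subgraph
are reversed. -/
def IsReflect {α β : Type*} [DecidableEq β] (S : Set β) (X : Set α)
    (H H' : PlaneGraph α β) : Prop :=
  H'.graph = H.graph ∧ IsSeparatedBy H.graph S X ∧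
    (∀ v ∉ X, ∀ e, H.graph.Inc e v →
      (e ∈ S → H'.rot (v, e) = H.rot.symm (v, e)) ∧ (e ∉ S → H'.rot (v, e) = H.rot (v, e))) ∧
    ∀ x ∈ X, ∃ s r : List β, (∀ e ∈ s, e ∈ S) ∧ (∀ e ∈ r, e ∉ S) ∧
      H.HasOrder x (s ++ r) ∧ H'.HasOrder x (s.reverse ++ r)

/-- `H'` arises from `H` by sliding the subgraph with edge set `S`, which is separated from the
rest by `X` and occupies an interval `s` of the circular order around each vertex of `X`: this
interval is moved to a new position in the circular order. -/
def IsSlide {α β : Type*} [DecidableEq β] (S : Set β) (X : Set α)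
    (H H' : PlaneGraph α β) : Prop :=
  H'.graph = H.graph ∧ IsSeparatedBy H.graph S X ∧
    (∀ v ∉ X, ∀ e, H.graph.Inc e v → H'.rot (v, e) = H.rot (v, e)) ∧
    ∀ x ∈ X, ∃ s r₁ r₂ : List β, (∀ e ∈ s, e ∈ S) ∧ (∀ e ∈ r₁ ++ r₂, e ∉ S) ∧
      H.HasOrder x (s ++ r₁ ++ r₂) ∧ H'.HasOrder x (r₁ ++ s ++ r₂)

/-- An articulation flip: reflect or slide a subgraph separated from the rest by one vertex. -/
def IsArticulationFlip {α β : Type*} [DecidableEq β] (H H' : PlaneGraph α β) : Prop :=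
  ∃ (S : Set β) (x : α), IsReflect S {x} H H' ∨ IsSlide S {x} H H'

/-- A separation flip: reflect or slide a subgraph separated from the rest by two vertices. -/
def IsSeparationFlip {α β : Type*} [DecidableEq β] (H H' : PlaneGraph α β) : Prop :=
  ∃ (S : Set β) (x y : α), x ≠ y ∧ (IsReflect S {x, y} H H' ∨ IsSlide S {x, y} H H')

end PlaneGraph

/-- The flip-graph: its vertices are all plane embedded graphs (with vertex labels in `α` and edge
labels in `β`), and two of them are adjacent if they differ by the deletion of one edge or by
one flip. -/
def flipGraph (α β : Type*) [DecidableEq β] : SimpleGraph (PlaneGraph α β) :=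
  SimpleGraph.fromRel fun H H' =>
    (∃ e, H.IsDeletion e H') ∨ H.IsArticulationFlip H' ∨ H.IsSeparationFlip H'

/-- The flip-distance between two sets of plane embedded graphs: the Hausdorff distance with respect
to the length of shortest paths in the flip-graph. -/
noncomputable def flipDist {α β : Type*} [DecidableEq β] (A B : Set (PlaneGraph α β)) : ℕ∞ :=
  max (⨆ a ∈ A, ⨅ b ∈ B, (flipGraph α β).edist a b)
    (⨆ b ∈ B, ⨅ a ∈ A, (flipGraph α β).edist a b)

/-! ### The two families of graphs -/

/-- The multigraph with vertex set `V` and edge set `E`, the edge `e` having the ends `ends e`. -/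
def Graph.ofEnds {α β : Type*} (V : Set α) (E : Set β) (ends : β → Sym2 α)
    (h : ∀ e ∈ E, ∀ x ∈ ends e, x ∈ V) : Graph α β where
  vertexSet := V
  edgeSet := E
  IsLink e x y := e ∈ E ∧ ends e = s(x, y)
  isLink_symm e _ := ⟨fun x y hxy => ⟨hxy.1, hxy.2.trans Sym2.eq_swap⟩⟩
  eq_or_eq_of_isLink_of_isLink e x y v w h₁ h₂ := by
    have h₃ := h₁.2.symm.trans h₂.2
    rw [Sym2.eq_iff] at h₃
    tauto
  edge_mem_iff_exists_isLink e := by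
    refine ⟨fun he => ?_, fun ⟨_, _, he⟩ => he.1⟩
    obtain ⟨x, y, hxy⟩ : ∃ x y, ends e = s(x, y) := by
      induction ends e using Sym2.ind with
      | _ x y => exact ⟨x, y, rfl⟩
    exact ⟨x, y, he, hxy⟩
  left_mem_of_isLink e x y hxy := h e hxy.1 x (by rw [hxy.2]; exact Sym2.mem_mk_left x y)

/-- The wheel graph `W_n` on `n` vertices: the rim vertices `0, …, n - 2` and the hub `n - 1`.
The edge `2 * i` is the spoke joining the hub to `i`, and the edge `2 * i + 1` is the rim edge
joining `i` to its cyclic successor `(i + 1) % (n - 1)`, for `i < n - 1`. -/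
def wheel (n : ℕ) : Graph ℕ ℕ :=
  Graph.ofEnds {v | v < n} {d | d < 2 * (n - 1)}
    (fun d => if d % 2 = 0 then s(n - 1, d / 2) else s(d / 2, (d / 2 + 1) % (n - 1)))
    (by
      intro d hd x hx
      have hd' : d < 2 * (n - 1) := hd
      have hm : (d / 2 + 1) % (n - 1) < n - 1 := Nat.mod_lt _ (by omega)
      show x < n
      split_ifs at hx <;> rw [Sym2.mem_iff] at hx <;> omega)

/-- The circular ladder `CL_k` with `2k` vertices `a_i = 2 * i` and `b_i = 2 * i + 1`, for `i < k`.
The edge `3 * i` is the rung `a_i b_i`, and the edges `3 * i + 1` and `3 * i + 2` are `a_i a_j` and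
`b_i b_j`, with `j = (i + 1) % k`. -/
def circularLadder (k : ℕ) : Graph ℕ ℕ :=
  Graph.ofEnds {v | v < 2 * k} {d | d < 3 * k}
    (fun d =>
      if d % 3 = 0 then s(2 * (d / 3), 2 * (d / 3) + 1)
      else if d % 3 = 1 then s(2 * (d / 3), 2 * ((d / 3 + 1) % k))
      else s(2 * (d / 3) + 1, 2 * ((d / 3 + 1) % k) + 1))
    (by
      intro d hd x hx
      have hd' : d < 3 * k := hd
      have hm : (d / 3 + 1) % k < k := Nat.mod_lt _ (by omega)
      show x < 2 * k
      split_ifs at hx <;> rw [Sym2.mem_iff] at hx <;> omega)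

/-- The cubic modification of `CL_k`: the two consecutive rungs `k - 1` and `0` are contracted
(deleted, and their ends identified: `b_(k-1)` with `a_(k-1)`, and `b_0` with `a_0`), and
`b_(k-1) b_0`, one of the two edges that became parallel, is removed. -/
def cubicLadder (k : ℕ) : Graph ℕ ℕ :=
  ((circularLadder k).deleteEdges {0, 3 * (k - 1), 3 * (k - 1) + 2}).map
    (fun v => if v = 1 then 0 else if v = 2 * (k - 1) + 1 then 2 * (k - 1) else v)

/-- The other one of the two parallel edges, `a_(k-1) a_0`. -/
def cubicLadderEdge (k : ℕ) : ℕ := 3 * (k - 1) + 1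

/-!
Both lower bounds come from an invariant that is local in the graph.  Consider two adjacent vertices
`v` and `w` of degree three, and the question whether their circular orders have the same
orientation (`PlaneGraph.SameOrientation`).  Deleting or inserting an edge affects the answer only
if `v` or `w` is an end of this edge.  A slide changes no circular order outside the separating
vertices.  A reflection inverts the circular orders in one subgraph; since the edge `vw` is in this
subgraph or outside of it, both orientations change or none, unless `v` or `w` is a separating
vertex.  So one step in the flip-graph affects only the pairs that meet one of two vertices
(`PlaneGraph.sameOrientation_iff_of_adj`), and among the pairs of consecutive vertices of a path
these are at most four.  It follows that two embeddings that differ on linearly many pairs have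
linear flip-distance, whatever the graphs between them are (`PlaneGraph.le_mul_flipDist`).

In every plane embedding of the wheel, and of the cubic ladder, all pairs along the path in question
agree in their orientation.  This rests on a discrete Jordan curve theorem
(`PlaneGraph.exists_sides`).  The facial boundaries span a subspace of the cycle space modulo two,
and Euler's formula says that the dimensions are equal; hence every cycle `C` is a sum of facial
boundaries, and the darts have two sides with respect to `C`.  For the wheel, `C` is the rim, and
all spokes are on the side of the hub; for the ladder, `C` is the cycle of the `a_j`, and all rungs
are on the side of the `b_j`.

Without the edge `e` there are embeddings with opposite orientations for all consecutive pairs.  The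
fan is drawn with its rim on a line and the spokes going alternately up and down to a hub at
infinity; in the open ladder every other rung is turned around.  These embeddings, and those that
show planarity, are given by explicit circular orders (`exists_planeGraph`).  The inequality
`V + F ≤ E + 2c` holds for every rotation system by the same dimension count (`Graph.euler_le`), so
that it suffices to exhibit enough faces, by labels that are constant along facial walks.
-/

/-! ### Boundaries modulo two of an embedded graph -/

namespace Graph

variable {α β : Type*}

/-- The components of a multigraph. -/
abbrev Component (G : Graph α β) : Type _ := Quot fun u v : G.vertexSet => G.Adj u.1 v.1

/-- The facial walks of a rotation system: those of positive length and the isolated vertices. -/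
abbrev Face (G : Graph α β) (rot : Equiv.Perm (α × β)) : Type _ :=
  (Quot fun d d' : G.darts => ∃ w, G.IsLink d.1.2 d.1.1 w ∧ d'.1 = rot (w, d.1.2)) ⊕
    {v | v ∈ G.vertexSet ∧ ∀ e, ¬ G.Inc e v}

theorem finite_darts {G : Graph α β} (hV : G.vertexSet.Finite) (hE : G.edgeSet.Finite) :
    G.darts.Finite :=
  (hV.prod hE).subset fun _ hd => ⟨Inc.vertex_mem hd, Inc.edge_mem hd⟩

theorem finite_face {G : Graph α β} (hV : G.vertexSet.Finite) (hE : G.edgeSet.Finite)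
    (rot : Equiv.Perm (α × β)) : Finite (G.Face rot) := by
  have := (finite_darts hV hE).to_subtype
  have := (hV.subset (fun v hv => hv.1 :
    {v | v ∈ G.vertexSet ∧ ∀ e, ¬ G.Inc e v} ⊆ G.vertexSet)).to_subtype
  infer_instance

theorem numFaces_eq_card_face {G : Graph α β} (hV : G.vertexSet.Finite) (hE : G.edgeSet.Finite)
    (rot : Equiv.Perm (α × β)) : G.numFaces rot = Nat.card (G.Face rot) := by
  have := (finite_darts hV hE).to_subtype
  have := (hV.subset (fun v hv => hv.1 :
    {v | v ∈ G.vertexSet ∧ ∀ e, ¬ G.Inc e v} ⊆ G.vertexSet)).to_subtype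
  rw [Nat.card_sum, numFaces, Nat.card_coe_set_eq]

/-- The darts at `v` are permuted among themselves. -/
theorem rot_mem {G : Graph α β} {rot : Equiv.Perm (α × β)}
    (hrot : ∀ v, rot.IsCycleOn {d | d ∈ G.darts ∧ d.1 = v}) {d : α × β} (hd : d ∈ G.darts) :
    rot d ∈ G.darts ∧ (rot d).1 = d.1 :=
  (hrot d.1).1.mapsTo ⟨hd, rfl⟩

variable (G : Graph α β) (rot : Equiv.Perm (α × β))

/-- The face on which the dart `(v, e)` lies. -/
def faceOf {v : α} {e : β} (h : G.Inc e v) : G.Face rot := Sum.inl (Quot.mk _ ⟨(v, e), h⟩)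

variable {G rot}

theorem faceOf_rot (hrot : ∀ v, rot.IsCycleOn {d | d ∈ G.darts ∧ d.1 = v}) {e : β} {u w : α}
    (h : G.IsLink e u w) :
    G.faceOf rot (v := (rot (u, e)).1) (e := (rot (u, e)).2)
      (rot_mem hrot (d := (u, e)) h.inc_left).1 = G.faceOf rot h.inc_right := by
  refine congrArg Sum.inl (Quot.sound ?_).symm
  exact ⟨u, h.symm, rfl⟩

open Classical in
/-- A chain of faces as a function of all pairs, zero on the pairs that are not darts. -/
noncomputable def dartValue (f : G.Face rot → ZMod 2) (d : α × β) : ZMod 2 :=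
  if h : G.Inc d.2 d.1 then f (G.faceOf rot h) else 0

theorem dartValue_of_inc (f : G.Face rot → ZMod 2) {v : α} {e : β} (h : G.Inc e v) :
    dartValue f (v, e) = f (G.faceOf rot h) :=
  dif_pos h

theorem dartValue_rot (hrot : ∀ v, rot.IsCycleOn {d | d ∈ G.darts ∧ d.1 = v})
    (f : G.Face rot → ZMod 2) {e : β} {u w : α} (h : G.IsLink e u w) :
    dartValue f (rot (u, e)) = dartValue f (w, e) := by
  rw [dartValue_of_inc f h.inc_right, ← faceOf_rot hrot h]
  exact dartValue_of_inc f (rot_mem hrot (d := (u, e)) h.inc_left).1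

/-- A function of the darts that does not change under rotation depends on the vertex only. -/
theorem eq_of_rot_invariant (hV : G.vertexSet.Finite) (hE : G.edgeSet.Finite)
    (hrot : ∀ v, rot.IsCycleOn {d | d ∈ G.darts ∧ d.1 = v}) {γ : Type*} (φ : α × β → γ) {v : α}
    (hφ : ∀ e, G.Inc e v → φ (rot (v, e)) = φ (v, e)) {e e' : β} (h : G.Inc e v)
    (h' : G.Inc e' v) : φ (v, e) = φ (v, e') := by
  have hs : {d | d ∈ G.darts ∧ d.1 = v}.Finite := (finite_darts hV hE).subset fun d hd => hd.1
  have hc := hrot v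
  rw [← hs.coe_toFinset] at hc
  have hpow : ∀ n : ℕ, (rot ^ n) (v, e) ∈ {d | d ∈ G.darts ∧ d.1 = v} ∧
      φ ((rot ^ n) (v, e)) = φ (v, e) := by
    intro n
    induction n with
    | zero => exact ⟨⟨h, rfl⟩, rfl⟩
    | succ n ih =>
      rw [pow_succ', Equiv.Perm.mul_apply]
      refine ⟨(hrot v).1.mapsTo ih.1, ?_⟩
      rw [← ih.2]
      obtain ⟨⟨h₁, h₂⟩, -⟩ := ih
      generalize (rot ^ n) (v, e) = d at h₁ h₂
      obtain ⟨u, e'⟩ := d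
      obtain rfl : u = v := h₂
      exact hφ e' h₁
  obtain ⟨n, -, hn⟩ := hc.exists_pow_eq (a := (v, e)) (b := (v, e')) (hs.mem_toFinset.2 ⟨h, rfl⟩)
    (hs.mem_toFinset.2 ⟨h', rfl⟩)
  rw [← hn, (hpow n).2]

variable (G) in
/-- The first end of an edge, the ends being ordered arbitrarily. -/
noncomputable def end₁ (e : G.edgeSet) : α := (exists_isLink_of_mem_edgeSet e.2).choose

variable (G) in
/-- The second end of an edge, the ends being ordered arbitrarily. -/
noncomputable def end₂ (e : G.edgeSet) : α := (exists_isLink_of_mem_edgeSet e.2).choose_spec.choose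

theorem isLink_ends (e : G.edgeSet) : G.IsLink e (G.end₁ e) (G.end₂ e) :=
  (exists_isLink_of_mem_edgeSet e.2).choose_spec.choose_spec

variable (G rot) in
/-- The boundary modulo two of a chain of faces: the sum of the values on the two sides of
each edge. -/
noncomputable def faceBoundary : (G.Face rot → ZMod 2) →ₗ[ZMod 2] (G.edgeSet → ZMod 2) where
  toFun f e := f (G.faceOf rot (isLink_ends e).inc_left) +
    f (G.faceOf rot (isLink_ends e).inc_right)
  map_add' f g := by ext e; simp only [Pi.add_apply]; ring
  map_smul' c f := by ext e; simp only [Pi.smul_apply, smul_eq_mul, RingHom.id_apply]; ring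

theorem faceBoundary_apply (f : G.Face rot → ZMod 2) {e : β} {u w : α} (h : G.IsLink e u w) :
    G.faceBoundary rot f ⟨e, h.edge_mem⟩ =
      dartValue f (u, e) + dartValue f (w, e) := by
  have hl := isLink_ends ⟨e, h.edge_mem⟩
  have h₀ : G.faceBoundary rot f ⟨e, h.edge_mem⟩ = dartValue f (G.end₁ ⟨e, h.edge_mem⟩, e) +
      dartValue f (G.end₂ ⟨e, h.edge_mem⟩, e) := by
    rw [dartValue_of_inc f hl.inc_left, dartValue_of_inc f hl.inc_right]
    rfl
  rw [h₀]
  obtain ⟨h₁, h₂⟩ | ⟨h₁, h₂⟩ := hl.eq_and_eq_or_eq_and_eq h <;> rw [h₁, h₂]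
  rw [add_comm]

variable (G) in
open Classical in
/-- The incidence matrix modulo two. -/
noncomputable def incMatrix : Matrix G.vertexSet G.edgeSet (ZMod 2) :=
  Matrix.of fun v e => if G.Inc e.1 v.1 then 1 else 0

/-- The rank of the incidence matrix is at least the number of vertices minus the number of
components, because a vector killed by the transpose is constant on every component. -/
theorem finrank_ker_incMatrix [Fintype G.vertexSet] [Fintype G.edgeSet] [G.Loopless] :
    Module.finrank (ZMod 2) (LinearMap.ker G.incMatrix.mulVecLin) + Fintype.card G.vertexSet ≤
      Fintype.card G.edgeSet + G.numComponents := by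
  classical
  have h₁ := G.incMatrix.mulVecLin.finrank_range_add_finrank_ker
  have h₂ := G.incMatrix.transpose.mulVecLin.finrank_range_add_finrank_ker
  have h₃ : G.incMatrix.transpose.rank = G.incMatrix.rank := Matrix.rank_transpose _
  rw [Matrix.rank, Matrix.rank] at h₃
  rw [Module.finrank_fintype_fun_eq_card] at h₁ h₂
  have : Finite G.Component := inferInstance
  have := Fintype.ofFinite G.Component
  let Φ : (G.Component → ZMod 2) →ₗ[ZMod 2] (G.vertexSet → ZMod 2) :=
    LinearMap.funLeft (ZMod 2) (ZMod 2) (Quot.mk _)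
  have hle : LinearMap.ker G.incMatrix.transpose.mulVecLin ≤ LinearMap.range Φ := by
    intro g hg
    have hadj : ∀ u v : G.vertexSet, G.Adj u.1 v.1 → g u = g v := by
      rintro u v ⟨e, he⟩
      have h := congrFun (LinearMap.mem_ker.1 hg) ⟨e, he.edge_mem⟩
      have huv : u ≠ v := fun h => he.ne (congrArg _ h)
      have hs : G.incMatrix.transpose.mulVecLin g ⟨e, he.edge_mem⟩ =
          ∑ x : G.vertexSet, if x ∈ ({u, v} : Finset G.vertexSet) then g x else 0 := by
        simp only [Matrix.mulVecLin_apply, Matrix.mulVec, dotProduct, Matrix.transpose_apply,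
          incMatrix, Matrix.of_apply, ite_mul, one_mul, zero_mul]
        refine Finset.sum_congr rfl fun x _ => if_congr ?_ rfl rfl
        simp only [Finset.mem_insert, Finset.mem_singleton, Subtype.ext_iff]
        refine ⟨fun hx => hx.eq_or_eq_of_isLink he, ?_⟩
        rintro (hx | hx) <;> rw [hx]
        exacts [he.inc_left, he.inc_right]
      rw [hs, Finset.sum_ite_mem, Finset.univ_inter, Finset.sum_pair huv] at h
      exact CharTwo.add_eq_zero.1 h
    exact ⟨Quot.lift g hadj, rfl⟩
  have h₄ := Submodule.finrank_mono hle
  have h₅ := LinearMap.finrank_range_le Φ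
  rw [Module.finrank_fintype_fun_eq_card, ← Nat.card_eq_fintype_card] at h₅
  have h₆ : Nat.card G.Component = G.numComponents := rfl
  omega

/-- A chain of faces with zero boundary takes the same value on all faces of a component. -/
theorem finrank_ker_faceBoundary (hV : G.vertexSet.Finite) (hE : G.edgeSet.Finite)
    (hrot : ∀ v, rot.IsCycleOn {d | d ∈ G.darts ∧ d.1 = v}) :
    Module.finrank (ZMod 2) (LinearMap.ker (G.faceBoundary rot)) ≤ G.numComponents := by
  classical
  have := hV.to_subtype
  have : Finite G.Component := inferInstance
  have := Fintype.ofFinite G.Component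
  let comp : G.Face rot → G.Component := Sum.elim
    (Quot.lift (fun d => Quot.mk _ ⟨d.1.1, Inc.vertex_mem d.2⟩) (by
      rintro d d' ⟨w, hw, hd'⟩
      have h₁ : d'.1.1 = w := by
        rw [hd']; exact (rot_mem hrot (d := (w, d.1.2)) hw.inc_right).2
      subst h₁
      exact Quot.sound ⟨d.1.2, hw⟩))
    (fun v => Quot.mk _ ⟨v.1, v.2.1⟩)
  let Φ : (G.Component → ZMod 2) →ₗ[ZMod 2] (G.Face rot → ZMod 2) :=
    LinearMap.funLeft (ZMod 2) (ZMod 2) comp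
  have hle : LinearMap.ker (G.faceBoundary rot) ≤ LinearMap.range Φ := by
    intro f hf
    have hlink : ∀ {e u w}, G.IsLink e u w → dartValue f (u, e) = dartValue f (w, e) :=
      fun {e u w} h => by
        have h₁ := congrFun (LinearMap.mem_ker.1 hf) ⟨e, h.edge_mem⟩
        rw [faceBoundary_apply f h] at h₁
        exact CharTwo.add_eq_zero.1 h₁
    have hvert : ∀ {v e e'}, G.Inc e v → G.Inc e' v → dartValue f (v, e) = dartValue f (v, e') := by
      intro v e e' h h'
      refine eq_of_rot_invariant hV hE hrot (dartValue f) ?_ h h'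
      rintro e₁ ⟨w, h₁⟩
      rw [dartValue_rot hrot f h₁, hlink h₁]
    let g : G.vertexSet → ZMod 2 := fun v =>
      if h : ∃ e, G.Inc e v.1 then dartValue f (v.1, h.choose)
      else f (Sum.inr ⟨v.1, v.2, not_exists.1 h⟩)
    have hg : ∀ (v : α) (e : β) (h : G.Inc e v),
        g ⟨v, h.vertex_mem⟩ = dartValue f (v, e) := by
      intro v e h
      have h' : ∃ e, G.Inc e v := ⟨e, h⟩
      change (if h : ∃ e, G.Inc e v then _ else _) = _
      rw [dif_pos h']
      exact hvert h'.choose_spec h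
    refine ⟨Quot.lift g ?_, ?_⟩
    · rintro ⟨u, hu⟩ ⟨v, hv⟩ ⟨e, he⟩
      rw [hg u e he.inc_left, hg v e he.inc_right, hlink he]
    · funext x
      rcases x with x | ⟨v, hv⟩
      · induction x using Quot.ind with
        | mk d => exact (hg d.1.1 d.1.2 d.2).trans (dartValue_of_inc f d.2)
      · have h' : ¬ ∃ e, G.Inc e v := not_exists.2 hv.2
        change (if h : ∃ e, G.Inc e v then _ else _) = _
        rw [dif_neg h']
  have h₄ := Submodule.finrank_mono hle
  have h₅ := LinearMap.finrank_range_le Φ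
  rw [Module.finrank_fintype_fun_eq_card, ← Nat.card_eq_fintype_card] at h₅
  exact h₄.trans h₅

/-- The boundary of a face is a cycle. -/
theorem range_faceBoundary_le [Fintype G.edgeSet] [Fintype G.vertexSet]
    (hrot : ∀ v, rot.IsCycleOn {d | d ∈ G.darts ∧ d.1 = v}) :
    LinearMap.range (G.faceBoundary rot) ≤ LinearMap.ker G.incMatrix.mulVecLin := by
  classical
  rintro _ ⟨f, rfl⟩
  rw [LinearMap.mem_ker]
  funext v
  have hb : ∀ e : G.edgeSet, G.Inc e.1 v.1 → G.faceBoundary rot f e =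
      dartValue f (v.1, e.1) + dartValue f (rot (v.1, e.1)) := by
    rintro e ⟨w, h⟩
    rw [dartValue_rot hrot f h]
    exact faceBoundary_apply f h
  simp only [Matrix.mulVecLin_apply, Matrix.mulVec, dotProduct, incMatrix, Matrix.of_apply, ite_mul,
    one_mul, zero_mul, Pi.zero_apply]
  rw [← Finset.sum_filter, Finset.sum_congr rfl (fun e he => hb e (Finset.mem_filter.1 he).2),
    Finset.sum_add_distrib, CharTwo.add_eq_zero]
  -- Both sums run over the darts at `v`, which are permuted by `rot`.
  have hs : {d | d ∈ G.darts ∧ d.1 = v.1}.Finite :=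
    (finite_darts (Set.toFinite _) (Set.toFinite _)).subset fun d hd => hd.1
  have hsum : ∀ ψ : α × β → ZMod 2, (∑ e : G.edgeSet with G.Inc e.1 v.1, ψ (v.1, e.1)) =
      ∑ d ∈ hs.toFinset, ψ d := by
    intro ψ
    refine Finset.sum_nbij (fun e => (v.1, e.1)) ?_ ?_ ?_ fun _ _ => rfl
    · intro e he
      simpa [darts] using he
    · intro e _ e' _ h
      exact Subtype.ext (Prod.ext_iff.1 h).2
    · rintro ⟨u, e⟩ hd
      obtain ⟨h₁, rfl⟩ : G.Inc e u ∧ u = v.1 := by simpa [darts] using hd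
      exact ⟨⟨e, h₁.edge_mem⟩, by simpa using h₁, rfl⟩
  rw [hsum, hsum (fun d => dartValue f (rot d))]
  have hbij := hrot v.1
  rw [← hs.coe_toFinset] at hbij
  exact (Finset.sum_nbij rot hbij.1.mapsTo hbij.1.injOn hbij.1.surjOn fun _ _ => rfl).symm

/-- The genus of a rotation system is not negative. -/
theorem euler_le (hV : G.vertexSet.Finite) (hE : G.edgeSet.Finite) (hG : G.Loopless)
    (hrot : ∀ v, rot.IsCycleOn {d | d ∈ G.darts ∧ d.1 = v}) :
    G.vertexSet.ncard + G.numFaces rot ≤ G.edgeSet.ncard + 2 * G.numComponents := by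
  have := hV.fintype
  have := hE.fintype
  have := finite_face hV hE rot
  have := Fintype.ofFinite (G.Face rot)
  have h₁ := G.finrank_ker_incMatrix
  have h₂ := finrank_ker_faceBoundary hV hE hrot
  have h₃ := Submodule.finrank_mono (range_faceBoundary_le hrot)
  have h₄ := (G.faceBoundary rot).finrank_range_add_finrank_ker
  rw [Module.finrank_fintype_fun_eq_card, ← Nat.card_eq_fintype_card,
    ← numFaces_eq_card_face hV hE] at h₄
  rw [← Nat.card_eq_fintype_card, ← Nat.card_eq_fintype_card, Nat.card_coe_set_eq,
    Nat.card_coe_set_eq] at h₁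
  omega

end Graph

namespace PlaneGraph

variable {α β : Type*}

/-- In a plane embedded graph, every cycle is the boundary of a chain of faces: a dimension
count with Euler's formula. -/
theorem range_faceBoundary_eq_ker (H : PlaneGraph α β) [Fintype H.graph.vertexSet]
    [Fintype H.graph.edgeSet] :
    LinearMap.range (H.graph.faceBoundary H.rot) =
      LinearMap.ker H.graph.incMatrix.mulVecLin := by
  have hV := H.finite_vertexSet
  have hE := H.finite_edgeSet
  have := H.loopless
  have := Graph.finite_face hV hE H.rot
  have := Fintype.ofFinite (H.graph.Face H.rot)
  refine Submodule.eq_of_le_of_finrank_le (Graph.range_faceBoundary_le H.rot_isCycleOn) ?_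
  have h₁ := H.graph.finrank_ker_incMatrix
  have h₂ := Graph.finrank_ker_faceBoundary hV hE H.rot_isCycleOn
  have h₄ := (H.graph.faceBoundary H.rot).finrank_range_add_finrank_ker
  rw [Module.finrank_fintype_fun_eq_card, ← Nat.card_eq_fintype_card,
    ← Graph.numFaces_eq_card_face hV hE] at h₄
  rw [← Nat.card_eq_fintype_card, ← Nat.card_eq_fintype_card, Nat.card_coe_set_eq,
    Nat.card_coe_set_eq] at h₁
  have := H.euler
  omega

/-- A discrete Jordan curve theorem.  A set `C` of edges with an even number of them at each vertex
separates the faces into two sides: each edge in `C` has a dart on either side, while the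
two darts of any other edge, and the darts at a corner between two edges, are on the same side. -/
theorem exists_sides (H : PlaneGraph α β) (C : Set β)
    (hC : ∀ v, Even {e | e ∈ C ∧ H.graph.Inc e v}.ncard) :
    ∃ side : Set (α × β), ∀ e u w, H.graph.IsLink e u w →
      (H.rot (u, e) ∈ side ↔ (w, e) ∈ side) ∧
        ((w, e) ∈ side ↔ ((u, e) ∈ side ↔ e ∉ C)) := by
  classical
  have := H.finite_vertexSet.fintype
  have := H.finite_edgeSet.fintype
  let z : H.graph.edgeSet → ZMod 2 := fun e => if e.1 ∈ C then 1 else 0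
  have hz : z ∈ LinearMap.ker H.graph.incMatrix.mulVecLin := by
    rw [LinearMap.mem_ker]
    funext v
    simp only [Matrix.mulVecLin_apply, Matrix.mulVec, dotProduct, Graph.incMatrix, Matrix.of_apply,
      z, mul_ite, ite_mul, one_mul, zero_mul, mul_zero, Pi.zero_apply, ← ite_and]
    rw [← Finset.sum_filter, Finset.sum_const, nsmul_one, ZMod.natCast_eq_zero_iff_even]
    convert hC v.1 using 1
    rw [← Set.ncard_coe_finset, ← Set.ncard_image_of_injective _ Subtype.val_injective]
    congr 1
    ext e
    simp only [Finset.coe_filter, Finset.mem_univ, true_and, Set.mem_image, Set.mem_ofPred_eq,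
      Subtype.exists, exists_and_right, exists_eq_right]
    exact ⟨fun ⟨⟨_, h⟩, h'⟩ => ⟨h, h'⟩, fun h => ⟨⟨h.2.edge_mem, h.1⟩, h.2⟩⟩
  rw [← range_faceBoundary_eq_ker] at hz
  obtain ⟨f, hf⟩ := hz
  refine ⟨{d | Graph.dartValue f d = 1}, fun e u w h => ?_⟩
  have h₁ := congrFun hf ⟨e, h.edge_mem⟩
  rw [Graph.faceBoundary_apply f h] at h₁
  simp only [Set.mem_ofPred_eq, Graph.dartValue_rot H.rot_isCycleOn f h, true_and]
  have key : ∀ a b : ZMod 2, ∀ p : Prop, [Decidable p] → a + b = (if p then 1 else 0) →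
      (b = 1 ↔ (a = 1 ↔ ¬ p)) := by
    intro a b p _ hab
    by_cases hp : p <;> simp only [hp, if_true, if_false] at hab ⊢ <;> revert a b <;> decide
  exact key _ _ _ h₁

end PlaneGraph

/-! ### Flips and the orientation of adjacent cubic vertices -/

theorem ncard_lt_nat (n : ℕ) : {i | i < n}.ncard = n := by
  rw [show {i | i < n} = ((Finset.range n : Finset ℕ) : Set ℕ) from
    Set.ext fun i => Finset.mem_range.symm, Set.ncard_coe_finset, Finset.card_range]

namespace PlaneGraph

variable {α β : Type*}

/-- The edges at `v` are the three different edges `l`, `s` and `r`. -/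
def IsTriad (H : PlaneGraph α β) (v : α) (l s r : β) : Prop :=
  l ≠ s ∧ s ≠ r ∧ r ≠ l ∧ ∀ e, H.graph.Inc e v ↔ e = l ∨ e = s ∨ e = r

/-- The circular order at a vertex of degree three is one of the two possible ones. -/
theorem IsTriad.rot_cases {H : PlaneGraph α β} {v : α} {l s r : β} (h : H.IsTriad v l s r) :
    (H.rot (v, l) = (v, s) ∧ H.rot (v, s) = (v, r) ∧ H.rot (v, r) = (v, l)) ∨
      (H.rot (v, l) = (v, r) ∧ H.rot (v, r) = (v, s) ∧ H.rot (v, s) = (v, l)) := by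
  obtain ⟨hls, hsr, hrl, hinc⟩ := h
  have hc := H.rot_isCycleOn v
  have hmem : ∀ e, H.graph.Inc e v → ∃ e', (e' = l ∨ e' = s ∨ e' = r) ∧ H.rot (v, e) = (v, e') := by
    intro e he
    have h₁ := hc.1.mapsTo (show (v, e) ∈ {d | d ∈ H.graph.darts ∧ d.1 = v} from ⟨he, rfl⟩)
    refine ⟨(H.rot (v, e)).2, (hinc _).1 ?_, Prod.ext h₁.2 rfl⟩
    have h₂ : H.graph.Inc (H.rot (v, e)).2 (H.rot (v, e)).1 := h₁.1
    rwa [show (H.rot (v, e)).1 = v from h₁.2] at h₂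
  have hnt : {d | d ∈ H.graph.darts ∧ d.1 = v}.Nontrivial :=
    ⟨(v, l), ⟨(hinc l).2 (by simp), rfl⟩, (v, s), ⟨(hinc s).2 (by simp), rfl⟩, by simpa using hls⟩
  have hfix : ∀ e, H.graph.Inc e v → H.rot (v, e) ≠ (v, e) := fun e he =>
    hc.apply_ne hnt ⟨he, rfl⟩
  have hinj : ∀ e e', e ≠ e' → H.rot (v, e) ≠ H.rot (v, e') := fun e e' hne h =>
    hne (Prod.ext_iff.1 (H.rot.injective h)).2
  have hl := (hinc l).2 (by simp)
  have hs := (hinc s).2 (by simp)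
  have hr := (hinc r).2 (by simp)
  obtain ⟨l', hl', el⟩ := hmem l hl
  obtain ⟨s', hs', es⟩ := hmem s hs
  obtain ⟨r', hr', er⟩ := hmem r hr
  have f₁ := hfix l hl
  have f₂ := hfix s hs
  have f₃ := hfix r hr
  have i₁ := hinj l s hls
  have i₂ := hinj s r hsr
  have i₃ := hinj r l hrl
  rw [el, es, er] at *
  clear hinj hfix hmem hinc hc hnt
  simp only [Prod.mk.injEq, true_and, ne_eq] at *
  grind

/-- The vertices `v` and `w` have degree three, with the edges `l, s, r` and `r, s', r'`, so that
`r` joins them if they are different, and are embedded with the same orientation, where `s`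
corresponds to `s'`. -/
def SameOrientation (H : PlaneGraph α β) (v w : α) (l s r s' r' : β) : Prop :=
  H.IsTriad v l s r ∧ H.IsTriad w r s' r' ∧ (H.rot (v, l) = (v, s) ↔ H.rot (w, r) = (w, s'))

variable {H H' : PlaneGraph α β}

theorem isTriad_congr {H H' : PlaneGraph α β} {v : α}
    (h : ∀ e, H'.graph.Inc e v ↔ H.graph.Inc e v) (l s r : β) :
    H'.IsTriad v l s r ↔ H.IsTriad v l s r := by
  simp only [IsTriad, h]

/-- Away from the ends of the deleted edge, a deletion leaves the circular orders unchanged. -/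
theorem IsDeletion.sameOrientation_iff {e₀ : β} (h : H.IsDeletion e₀ H') :
    ∃ x y, ∀ v w, v ≠ x → v ≠ y → w ≠ x → w ≠ y → ∀ l s r s' r',
      H'.SameOrientation v w l s r s' r' ↔ H.SameOrientation v w l s r s' r' := by
  obtain ⟨he₀, hg, hrot⟩ := h
  obtain ⟨x, y, hxy⟩ := Graph.exists_isLink_of_mem_edgeSet he₀
  refine ⟨x, y, fun v w hvx hvy hwx hwy l s r s' r' => ?_⟩
  have hinc : ∀ v, v ≠ x → v ≠ y → ∀ e, H'.graph.Inc e v ↔ H.graph.Inc e v := by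
    intro v hvx hvy e
    rw [hg, Graph.deleteEdges_inc, and_iff_left_iff_imp]
    rintro h rfl
    exact (h.eq_or_eq_of_isLink hxy).elim hvx hvy
  have key : ∀ v, v ≠ x → v ≠ y → ∀ e, H.graph.Inc e v → H'.rot (v, e) = H.rot (v, e) := by
    intro v hvx hvy e he
    have hne : ∀ e, H.graph.Inc e v → e ≠ e₀ := by
      rintro e h rfl
      exact (h.eq_or_eq_of_isLink hxy).elim hvx hvy
    have h₁ := (H.rot_isCycleOn v).1.mapsTo
      (show (v, e) ∈ {d | d ∈ H.graph.darts ∧ d.1 = v} from ⟨he, rfl⟩)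
    refine (hrot (v, e) (hne e he)).1 (hne _ ?_)
    have h₂ : H.graph.Inc (H.rot (v, e)).2 (H.rot (v, e)).1 := h₁.1
    rwa [show (H.rot (v, e)).1 = v from h₁.2] at h₂
  unfold SameOrientation
  rw [isTriad_congr (hinc v hvx hvy), isTriad_congr (hinc w hwx hwy)]
  refine and_congr_right fun hv => and_congr_right fun hw => ?_
  rw [key v hvx hvy l ((hv.2.2.2 l).2 (by simp)), key w hwx hwy r ((hw.2.2.2 r).2 (by simp))]

theorem IsSlide.sameOrientation_iff [DecidableEq β] {S : Set β} {X : Set α}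
    (h : H.IsSlide S X H') {v w : α} (hv : v ∉ X) (hw : w ∉ X) (l s r s' r' : β) :
      H'.SameOrientation v w l s r s' r' ↔ H.SameOrientation v w l s r s' r' := by
  obtain ⟨hg, -, hrot, -⟩ := h
  unfold SameOrientation
  rw [isTriad_congr (H := H) (v := v) (fun e => by rw [hg]),
    isTriad_congr (H := H) (v := w) (fun e => by rw [hg])]
  refine and_congr_right fun hv' => and_congr_right fun hw' => ?_
  rw [hrot v hv l ((hv'.2.2.2 l).2 (by simp)), hrot w hw r ((hw'.2.2.2 r).2 (by simp))]

/-- The edge `r` belongs to `v` and to `w`, so that away from the separating vertices a reflection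
reverses either both orientations or none. -/
theorem IsReflect.sameOrientation_iff [DecidableEq β] {S : Set β} {X : Set α}
    (h : H.IsReflect S X H') {v w : α} (hv : v ∉ X) (hw : w ∉ X) (l s r s' r' : β) :
      H'.SameOrientation v w l s r s' r' ↔ H.SameOrientation v w l s r s' r' := by
  obtain ⟨hg, hsep, hrot, -⟩ := h
  unfold SameOrientation
  rw [isTriad_congr (H := H) (v := v) (fun e => by rw [hg]),
    isTriad_congr (H := H) (v := w) (fun e => by rw [hg])]
  refine and_congr_right fun hv' => and_congr_right fun hw' => ?_
  have hS : ∀ v ∉ X, ∀ e e', H.graph.Inc e v → H.graph.Inc e' v → (e ∈ S ↔ e' ∈ S) := by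
    intro v hv e e' he he'
    have h₁ := mt (hsep v).2 hv
    by_contra h₂
    rcases not_iff.1 h₂ with h₂
    by_cases h₃ : e ∈ S
    · exact h₁ ⟨⟨e, h₃, he⟩, e', fun h₄ => h₂.2 h₄ h₃, he'⟩
    · exact h₁ ⟨⟨e', h₂.1 h₃, he'⟩, e, h₃, he⟩
  -- Inverting the circular order exchanges the two orientations.
  have hflip : ∀ v ∉ X, ∀ l s r, H.IsTriad v l s r → l ∈ S →
      (H'.rot (v, l) = (v, s) ↔ ¬ H.rot (v, l) = (v, s)) := by
    intro v hv l s r ht hl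
    rw [(hrot v hv l ((ht.2.2.2 l).2 (by simp))).1 hl, Equiv.symm_apply_eq]
    obtain ⟨h₁, h₂, h₃⟩ | ⟨h₁, h₂, h₃⟩ := ht.rot_cases
    · simp [h₁, h₂, ht.2.2.1.symm]
    · simp [h₁, h₃, ht.2.1.symm]
  have hlr := hS v hv l r ((hv'.2.2.2 l).2 (by simp)) ((hv'.2.2.2 r).2 (by simp))
  by_cases hr : r ∈ S
  · rw [hflip v hv l s r hv' (hlr.2 hr), hflip w hw r s' r' hw' hr, not_iff_not]
  · rw [(hrot v hv l ((hv'.2.2.2 l).2 (by simp))).2 (mt hlr.1 hr),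
      (hrot w hw r ((hw'.2.2.2 r).2 (by simp))).2 hr]

/-- A step in the flip-graph, in either direction, does not change whether adjacent cubic vertices
have the same orientation, except for pairs that meet one of two vertices. -/
theorem sameOrientation_iff_of_adj [DecidableEq β] (h : (flipGraph α β).Adj H H') :
    ∃ x y, ∀ v w, v ≠ x → v ≠ y → w ≠ x → w ≠ y → ∀ l s r s' r',
      H'.SameOrientation v w l s r s' r' ↔ H.SameOrientation v w l s r s' r' := by
  have key : ∀ H H' : PlaneGraph α β,
      (∃ e, H.IsDeletion e H') ∨ H.IsArticulationFlip H' ∨ H.IsSeparationFlip H' →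
      ∃ x y, ∀ v w, v ≠ x → v ≠ y → w ≠ x → w ≠ y → ∀ l s r s' r',
        H'.SameOrientation v w l s r s' r' ↔ H.SameOrientation v w l s r s' r' := by
    rintro H H' (⟨e, h⟩ | ⟨S, x, h⟩ | ⟨S, x, y, -, h⟩)
    · exact h.sameOrientation_iff
    · exact ⟨x, x, fun v w hv _ hw _ => h.elim (fun h => h.sameOrientation_iff hv hw)
        fun h => h.sameOrientation_iff hv hw⟩
    · refine ⟨x, y, fun v w hvx hvy hwx hwy => ?_⟩
      have hv : v ∉ ({x, y} : Set α) := by simp [hvx, hvy]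
      have hw : w ∉ ({x, y} : Set α) := by simp [hwx, hwy]
      exact h.elim (fun h => h.sameOrientation_iff hv hw) fun h => h.sameOrientation_iff hv hw
  obtain ⟨-, h | h⟩ := (SimpleGraph.fromRel_adj _ _ _).1 h
  · exact key _ _ h
  · obtain ⟨x, y, h'⟩ := key _ _ h
    exact ⟨x, y, fun v w h₁ h₂ h₃ h₄ l s r s' r' => (h' v w h₁ h₂ h₃ h₄ l s r s' r').symm⟩

/-- Along a walk in the flip-graph, the number of pairs of consecutive vertices whose relative
orientation changes is at most four times the length: every step affects at most two vertices. -/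
theorem card_changed_le [DecidableEq β] {v : ℕ → α} {N : ℕ} (hv : Set.InjOn v {i | i ≤ N})
    (l s r s' r' : ℕ → β) (p : (flipGraph α β).Walk H H') :
    {i | i < N ∧ ¬ (H'.SameOrientation (v i) (v (i + 1)) (l i) (s i) (r i) (s' i) (r' i) ↔
      H.SameOrientation (v i) (v (i + 1)) (l i) (s i) (r i) (s' i) (r' i))}.ncard ≤
        4 * p.length := by
  induction p with
  | nil => simp
  | @cons A B C h p ih =>
    obtain ⟨x, y, hxy⟩ := sameOrientation_iff_of_adj h
    let D : α → Set ℕ := fun x => {i | i < N ∧ v i = x}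
    have hD : ∀ x, (D x).ncard ≤ 1 ∧ (D x).Finite := fun x => by
      have : (D x).Subsingleton := fun i hi j hj =>
        hv hi.1.le hj.1.le (hi.2.trans hj.2.symm)
      exact ⟨(Set.ncard_le_one this.finite).2 this, this.finite⟩
    let D' : α → Set ℕ := fun x => {i | i < N ∧ v (i + 1) = x}
    have hD' : ∀ x, (D' x).ncard ≤ 1 ∧ (D' x).Finite := fun x => by
      have : (D' x).Subsingleton := fun i hi j hj =>
        Nat.succ_injective (hv (Nat.succ_le_of_lt hi.1) (Nat.succ_le_of_lt hj.1)
          (hi.2.trans hj.2.symm))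
      exact ⟨(Set.ncard_le_one this.finite).2 this, this.finite⟩
    set U := {i | i < N ∧ ¬ (C.SameOrientation (v i) (v (i + 1)) (l i) (s i) (r i) (s' i) (r' i) ↔
      B.SameOrientation (v i) (v (i + 1)) (l i) (s i) (r i) (s' i) (r' i))} with hU
    have hUf : U.Finite := (Set.finite_lt_nat N).subset fun i hi => hi.1
    have hsub : {i | i < N ∧
        ¬ (C.SameOrientation (v i) (v (i + 1)) (l i) (s i) (r i) (s' i) (r' i) ↔
        A.SameOrientation (v i) (v (i + 1)) (l i) (s i) (r i) (s' i) (r' i))} ⊆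
        U ∪ ((D x ∪ D y) ∪ (D' x ∪ D' y)) := by
      rintro i ⟨hi, hne⟩
      by_contra hcon
      simp only [Set.mem_union, not_or] at hcon
      obtain ⟨h₀, ⟨h₁, h₂⟩, h₃, h₄⟩ := hcon
      have h₅ := hxy _ _ (fun h => h₁ ⟨hi, h⟩) (fun h => h₂ ⟨hi, h⟩) (fun h => h₃ ⟨hi, h⟩)
        (fun h => h₄ ⟨hi, h⟩) (l i) (s i) (r i) (s' i) (r' i)
      refine h₀ ⟨hi, fun h₆ => hne (h₆.trans h₅)⟩
    have hfin : (U ∪ ((D x ∪ D y) ∪ (D' x ∪ D' y))).Finite :=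
      hUf.union (((hD x).2.union (hD y).2).union ((hD' x).2.union (hD' y).2))
    have h₁ := Set.ncard_le_ncard hsub hfin
    have h₂ := Set.ncard_union_le U ((D x ∪ D y) ∪ (D' x ∪ D' y))
    have h₃ := Set.ncard_union_le (D x ∪ D y) (D' x ∪ D' y)
    have h₄ := Set.ncard_union_le (D x) (D y)
    have h₅ := Set.ncard_union_le (D' x) (D' y)
    have h₆ := (hD x).1
    have h₇ := (hD y).1
    have h₈ := (hD' x).1
    have h₉ := (hD' y).1
    rw [SimpleGraph.Walk.length_cons]
    omega

/-- If one embedding of the graphs in `A` gives opposite orientations to each of `N` pairs of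
consecutive cubic vertices, and every embedding in `B` gives them the same orientation, then the
distance of `A` and `B` is at least linear in `N`. -/
theorem le_mul_flipDist [DecidableEq β] {A B : Set (PlaneGraph α β)} {H : PlaneGraph α β}
    (hHA : H ∈ A) (hHB : H ∉ B) {v : ℕ → α} {N n K : ℕ}
    (hv : Set.InjOn v {i | i ≤ N}) (l s r s' r' : ℕ → β)
    (hA : ∀ i < N, ¬ H.SameOrientation (v i) (v (i + 1)) (l i) (s i) (r i) (s' i) (r' i))
    (hB : ∀ H' ∈ B, ∀ i < N,
      H'.SameOrientation (v i) (v (i + 1)) (l i) (s i) (r i) (s' i) (r' i))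
    (hK : ∀ m, 1 ≤ m → N ≤ 4 * m → n ≤ K * m) :
    (n : ℕ∞) ≤ K * flipDist A B := by
  obtain ⟨q, hq, hqn⟩ : ∃ q : ℕ, (∀ m, n ≤ K * m → q ≤ m) ∧ n ≤ K * q := by
    have h : ∃ m, n ≤ K * m :=
      ⟨N + 1, hK _ (by omega) (by omega)⟩
    classical
    exact ⟨Nat.find h, fun m hm => Nat.find_min' h hm, Nat.find_spec h⟩
  have hle : (q : ℕ∞) ≤ flipDist A B := by
    refine le_trans ?_ (le_max_left _ _)
    refine le_trans ?_ (le_iSup₂ (f := fun a _ => ⨅ b ∈ B, (flipGraph α β).edist a b) H hHA)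
    refine le_iInf₂ fun b hb => le_iInf fun p => Nat.cast_le.2 (hq _ (hK _ ?_ ?_))
    · rw [Nat.one_le_iff_ne_zero]
      intro h₀
      obtain rfl := SimpleGraph.Walk.eq_of_length_eq_zero h₀
      exact hHB hb
    · refine le_trans (le_of_eq ?_) (card_changed_le hv l s r s' r' p)
      rw [show {i | i < N ∧ _} = {i | i < N} from Set.ext fun i =>
        ⟨fun h => h.1, fun h => ⟨h, fun h' => hA i h (h'.1 (hB b hb i h))⟩⟩]
      exact (ncard_lt_nat N).symm
  calc (n : ℕ∞) ≤ ((K * q : ℕ) : ℕ∞) := Nat.cast_le.2 hqn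
    _ = K * q := by push_cast; rfl
    _ ≤ K * flipDist A B := by gcongr

/-- Let `C` be a cycle through the edge `r`, with the ends `v` and `w`.  If the edges `s` at `v`
and `s'` at `w` leave `C` on the same side, then the two orientations are the same. -/
theorem sameOrientation_of_sides {C : Set β} {side : Set (α × β)}
    (hside : ∀ e u w, H.graph.IsLink e u w →
      (H.rot (u, e) ∈ side ↔ (w, e) ∈ side) ∧ ((w, e) ∈ side ↔ ((u, e) ∈ side ↔ e ∉ C)))
    {v w : α} {l s r s' r' : β} (hv : H.IsTriad v l s r) (hw : H.IsTriad w r s' r')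
    (hr : H.graph.IsLink r v w) (hrC : r ∈ C) (hsC : s ∉ C)
    (hsC' : s' ∉ C) (hss : (v, s) ∈ side ↔ (w, s') ∈ side) :
    H.SameOrientation v w l s r s' r' := by
  refine ⟨hv, hw, ?_⟩
  have step : ∀ e u, H.graph.Inc e u → (H.rot (u, e) ∈ side ↔ ((u, e) ∈ side ↔ e ∉ C)) := by
    rintro e u ⟨w, h⟩
    exact (hside e u w h).1.trans (hside e u w h).2
  have h₂ := step s v ((hv.2.2.2 s).2 (by simp))
  have h₃ := step r v ((hv.2.2.2 r).2 (by simp))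
  have h₄ := step r w ((hw.2.2.2 r).2 (by simp))
  have h₅ := step s' w ((hw.2.2.2 s').2 (by simp))
  have h₇ := (hside r v w hr).2
  simp only [hrC, hsC, hsC', not_true, not_false_iff, iff_true, iff_false] at h₂ h₃ h₄ h₅ h₇
  have o₁ : H.rot (v, l) = (v, s) ↔ ((v, r) ∈ side ↔ (v, s) ∈ side) := by
    obtain ⟨a₁, a₂, a₃⟩ | ⟨a₁, a₂, a₃⟩ := hv.rot_cases
    · rw [a₂] at h₂
      simp only [a₁, h₂]
    · rw [a₂] at h₃
      simp only [a₁, h₃, Prod.mk.injEq, true_and, hv.2.1.symm, iff_not_self]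
  have o₂ : H.rot (w, r) = (w, s') ↔ ((w, s') ∈ side ↔ (w, r) ∉ side) := by
    obtain ⟨a₁, a₂, a₃⟩ | ⟨a₁, a₂, a₃⟩ := hw.rot_cases
    · rw [a₁] at h₄
      simp only [a₁, h₄]
    · rw [a₃] at h₅
      simp only [a₁, h₅, Prod.mk.injEq, true_and, hw.2.1.symm, iff_not_self]
  rw [o₁, o₂, hss, h₇, not_not]
  exact iff_comm

end PlaneGraph

/-! ### Embeddings from coded darts -/

namespace Graph

variable {α β : Type*} {G : Graph α β}

theorem numComponents_le_one {root : α} (κ : α → ℕ)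
    (hκ : ∀ v ∈ G.vertexSet, v ≠ root → ∃ u, G.Adj v u ∧ κ u < κ v) : G.numComponents ≤ 1 := by
  have key : ∀ (n : ℕ) (v : G.vertexSet), κ v ≤ n → ∃ h : root ∈ G.vertexSet,
      (Quot.mk _ v : G.Component) = Quot.mk _ ⟨root, h⟩ := by
    intro n
    induction n with
    | zero =>
      rintro ⟨v, hv⟩ hn
      by_cases h : v = root
      · subst h; exact ⟨hv, rfl⟩
      · obtain ⟨u, -, hu⟩ := hκ v hv h
        exact absurd (lt_of_lt_of_le hu hn) (Nat.not_lt_zero _)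
    | succ n ih =>
      rintro ⟨v, hv⟩ hn
      by_cases h : v = root
      · subst h; exact ⟨hv, rfl⟩
      · obtain ⟨u, hadj, hu⟩ := hκ v hv h
        obtain ⟨hr, h'⟩ := ih ⟨u, hadj.right_mem⟩ (Nat.le_of_lt_succ (lt_of_lt_of_le hu hn))
        refine ⟨hr, Eq.trans (Quot.sound ?_) h'⟩
        exact hadj
  have : Subsingleton G.Component := ⟨fun x y => by
    induction x using Quot.ind with
    | mk x =>
      induction y using Quot.ind with
      | mk y =>
        obtain ⟨_, h₁⟩ := key _ x le_rfl
        obtain ⟨_, h₂⟩ := key _ y le_rfl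
        exact h₁.trans h₂.symm⟩
  exact Finite.card_le_one_iff_subsingleton.2 this

/-- A labelling of the darts that is constant along facial walks bounds the number of faces
from below by the number of labels. -/
theorem le_numFaces (hV : G.vertexSet.Finite) (hE : G.edgeSet.Finite) {rot : Equiv.Perm (α × β)}
    {N : ℕ} (ℓ : α × β → ℕ) (hℓ : ∀ e u w, G.IsLink e u w → ℓ (rot (w, e)) = ℓ (u, e))
    (hsurj : ∀ q < N, ∃ d ∈ G.darts, ℓ d = q) : N ≤ G.numFaces rot := by
  have := (finite_darts hV hE).to_subtype
  let Q := Quot fun d d' : G.darts => ∃ w, G.IsLink d.1.2 d.1.1 w ∧ d'.1 = rot (w, d.1.2)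
  let F : Q → ℕ := Quot.lift (fun d => ℓ d.1) (by
    rintro ⟨⟨u, e⟩, hd⟩ ⟨d', hd'⟩ ⟨w, hw, rfl⟩
    exact (hℓ e u w hw).symm)
  refine le_trans ?_ (Nat.le_add_right _ _)
  have hsub : ((Finset.range N : Finset ℕ) : Set ℕ) ⊆ Set.range F := by
    intro q hq
    obtain ⟨d, hd, rfl⟩ := hsurj q (by simpa using hq)
    exact ⟨Quot.mk _ ⟨d, hd⟩, rfl⟩
  have h := Set.ncard_le_ncard hsub (Set.finite_range F)
  rw [Set.ncard_coe_finset, Finset.card_range, ← Set.image_univ] at h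
  refine h.trans ((Set.ncard_image_le (Set.toFinite _)).trans (le_of_eq ?_))
  exact Set.ncard_univ _

end Graph

/-- A connected graph whose darts are coded by the elements of `P` has a plane embedding with the
dart `nxt d` following the dart `d`, provided that the facial walks can be distinguished by
sufficiently many labels `ℓ`.  The code `rev d` is that of the other dart of the same edge, and
`ρ` measures the number of steps from a dart to a base dart at the same vertex. -/
theorem exists_planeGraph {α β γ : Type*} {G : Graph α β} (hV : G.vertexSet.Finite)
    (hE : G.edgeSet.Finite) (hG : G.Loopless) {root : α} (κ : α → ℕ)
    (hκ : ∀ v ∈ G.vertexSet, v ≠ root → ∃ u, G.Adj v u ∧ κ u < κ v)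
    {P : Set γ} (ι : γ → α × β) (hι : Set.InjOn ι P) (hP : ∀ d, d ∈ G.darts ↔ ∃ p ∈ P, ι p = d)
    (nxt rev : γ → γ) (hnxt : ∀ p ∈ P, nxt p ∈ P ∧ (ι (nxt p)).1 = (ι p).1)
    (hinj : Set.InjOn nxt P) (ρ : γ → ℕ) (hρ : ∀ p ∈ P, ρ p ≠ 0 → ρ (nxt p) < ρ p)
    (hbase : ∀ p ∈ P, ∀ p' ∈ P, ρ p = 0 → ρ p' = 0 → (ι p).1 = (ι p').1 → p = p')
    (hrev : ∀ p ∈ P, rev p ∈ P ∧ (ι (rev p)).2 = (ι p).2 ∧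
      G.IsLink (ι p).2 (ι p).1 (ι (rev p)).1)
    (ℓ : γ → ℕ) (hℓ : ∀ p ∈ P, ℓ (nxt (rev p)) = ℓ p) {N : ℕ}
    (hsurj : ∀ q < N, ∃ p ∈ P, ℓ p = q)
    (hN : G.edgeSet.ncard + 2 ≤ G.vertexSet.ncard + N) :
    ∃ H : PlaneGraph α β, H.graph = G ∧ ∀ p ∈ P, H.rot (ι p) = ι (nxt p) := by
  classical
  have hfin := Graph.finite_darts hV hE
  have := hfin.to_subtype
  -- The code of a dart.
  have hcode : ∀ d : G.darts, ∃ p, p ∈ P ∧ ι p = d.1 := fun d => by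
    obtain ⟨p, hp, h⟩ := (hP _).1 d.2
    exact ⟨p, hp, h⟩
  choose c hcP hc using hcode
  have hdart : ∀ {p}, p ∈ P → ι p ∈ G.darts := fun hp => (hP _).2 ⟨_, hp, rfl⟩
  have hcι : ∀ {p} (hp : p ∈ P), c ⟨ι p, hdart hp⟩ = p := fun hp => hι (hcP _) hp (hc _)
  let f : G.darts → G.darts := fun d => ⟨ι (nxt (c d)), hdart (hnxt _ (hcP d)).1⟩
  have hf : f.Injective := by
    intro d d' h
    have h₁ := hι (hnxt _ (hcP d)).1 (hnxt _ (hcP d')).1 (congrArg Subtype.val h)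
    have h₂ := hinj (hcP d) (hcP d') h₁
    exact Subtype.ext ((hc d).symm.trans ((congrArg ι h₂).trans (hc d')))
  let σ : Equiv.Perm G.darts := Equiv.ofBijective f (Finite.injective_iff_bijective.1 hf)
  let rot : Equiv.Perm (α × β) := Equiv.Perm.ofSubtype σ
  have hrot : ∀ p ∈ P, rot (ι p) = ι (nxt p) := by
    intro p hp
    rw [show rot (ι p) = (σ ⟨ι p, hdart hp⟩ : α × β) from
      Equiv.Perm.ofSubtype_apply_of_mem σ (hdart hp)]
    change ι (nxt (c ⟨ι p, hdart hp⟩)) = _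
    rw [hcι hp]
  have hcyc : ∀ v, rot.IsCycleOn {d | d ∈ G.darts ∧ d.1 = v} := by
    intro v
    have hmaps : Set.MapsTo rot {d | d ∈ G.darts ∧ d.1 = v} {d | d ∈ G.darts ∧ d.1 = v} := by
      rintro d ⟨hd, rfl⟩
      obtain ⟨p, hp, rfl⟩ := (hP d).1 hd
      rw [hrot p hp]
      exact ⟨hdart (hnxt p hp).1, (hnxt p hp).2⟩
    have hfinv : {d | d ∈ G.darts ∧ d.1 = v}.Finite := hfin.subset fun d hd => hd.1
    refine ⟨(hfinv.injOn_iff_bijOn_of_mapsTo hmaps).1 rot.injective.injOn, ?_⟩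
    have hreach : ∀ (n : ℕ) (p : γ), p ∈ P → ρ p ≤ n → ∃ p₀ ∈ P, ρ p₀ = 0 ∧
          (ι p₀).1 = (ι p).1 ∧ rot.SameCycle (ι p) (ι p₀) := by
      intro n
      induction n with
      | zero => exact fun p hp hn => ⟨p, hp, Nat.le_zero.1 hn, rfl, Equiv.Perm.SameCycle.refl _ _⟩
      | succ n ih =>
        intro p hp hn
        by_cases h₀ : ρ p = 0
        · exact ⟨p, hp, h₀, rfl, Equiv.Perm.SameCycle.refl _ _⟩
        · obtain ⟨p₀, hp₀, h₁, h₂, h₃⟩ := ih (nxt p) (hnxt p hp).1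
            (Nat.le_of_lt_succ (lt_of_lt_of_le (hρ p hp h₀) hn))
          refine ⟨p₀, hp₀, h₁, h₂.trans (hnxt p hp).2, ?_⟩
          rw [← hrot p hp] at h₃
          exact Equiv.Perm.sameCycle_apply_left.1 h₃
    rintro d ⟨hd, hdv⟩ d' ⟨hd', hdv'⟩
    obtain ⟨p, hp, rfl⟩ := (hP d).1 hd
    obtain ⟨p', hp', rfl⟩ := (hP d').1 hd'
    obtain ⟨q, hq, h₁, h₂, h₃⟩ := hreach _ p hp le_rfl
    obtain ⟨q', hq', h₁', h₂', h₃'⟩ := hreach _ p' hp' le_rfl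
    obtain rfl := hbase q hq q' hq' h₁ h₁' (by rw [h₂, h₂', hdv, hdv'])
    exact h₃.trans h₃'.symm
  have hfaces : N ≤ G.numFaces rot := by
    refine Graph.le_numFaces hV hE (fun d => if h : d ∈ G.darts then ℓ (c ⟨d, h⟩) else 0) ?_ ?_
    · intro e u w h
      obtain ⟨p, hp, hpd⟩ := (hP (u, e)).1 h.inc_left
      have hrp : ι (rev p) = (w, e) := by
        obtain ⟨-, h₂, h₃⟩ := hrev p hp
        rw [hpd] at h₂ h₃
        exact Prod.ext (h₃.right_unique h) h₂
      rw [← hpd, ← hrp, hrot _ (hrev p hp).1]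
      have h₁ := hdart hp
      have h₂ := hdart (hnxt _ (hrev p hp).1).1
      simp only [dif_pos h₁, dif_pos h₂]
      rw [hcι hp, hcι (hnxt _ (hrev p hp).1).1, hℓ p hp]
    · intro q hq
      obtain ⟨p, hp, rfl⟩ := hsurj q hq
      exact ⟨ι p, hdart hp, by rw [dif_pos (hdart hp), hcι hp]⟩
  refine ⟨⟨G, hV, hE, hG, rot, fun d hd => Equiv.Perm.ofSubtype_apply_of_not_mem σ hd, hcyc, ?_⟩,
    rfl, hrot⟩
  refine le_antisymm (Graph.euler_le hV hE hG hcyc) ?_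
  have := Graph.numComponents_le_one κ hκ
  omega

/-! ### Wheels -/

theorem even_ncard_of_forall_notMem {s : Set ℕ} (hs : ∀ e, e ∉ s) : Even s.ncard := by
  rw [Set.eq_empty_of_forall_notMem hs, Set.ncard_empty]
  exact Even.zero

theorem succ_mod_eq {M j : ℕ} (hj : j < M) :
    (j + 1) % M = if j + 1 = M then 0 else j + 1 := by
  split_ifs with h
  · rw [h, Nat.mod_self]
  · exact Nat.mod_eq_of_lt (by omega)

namespace Wheel

/-- The links of a wheel with rim vertices `0, …, M - 1` and hub `M`. -/
theorem isLink_iff {M e x y : ℕ} : (wheel (M + 1)).IsLink e x y ↔ e < 2 * M ∧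
    (e % 2 = 0 ∧ (x = M ∧ y = e / 2 ∨ x = e / 2 ∧ y = M) ∨
      e % 2 = 1 ∧ e / 2 + 1 = M ∧ (x = e / 2 ∧ y = 0 ∨ x = 0 ∧ y = e / 2) ∨
      e % 2 = 1 ∧ e / 2 + 1 < M ∧ (x = e / 2 ∧ y = e / 2 + 1 ∨ x = e / 2 + 1 ∧ y = e / 2)) := by
  change (e < 2 * (M + 1 - 1) ∧ (if e % 2 = 0 then s(M + 1 - 1, e / 2) else
    s(e / 2, (e / 2 + 1) % (M + 1 - 1))) = s(x, y)) ↔ _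
  rw [Nat.add_sub_cancel]
  refine and_congr_right fun he => ?_
  rw [succ_mod_eq (show e / 2 < M by omega)]
  split_ifs with h₁ h₂ <;> rw [Sym2.eq_iff] <;> omega

theorem inc_iff {M e x : ℕ} : (wheel (M + 1)).Inc e x ↔ e < 2 * M ∧
    (e % 2 = 0 ∧ (x = M ∨ x = e / 2) ∨
      e % 2 = 1 ∧ (x = e / 2 ∨ e / 2 + 1 = M ∧ x = 0 ∨ e / 2 + 1 < M ∧ x = e / 2 + 1)) := by
  constructor
  · rintro ⟨y, h⟩
    rw [isLink_iff] at h
    omega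
  · rintro ⟨he, ⟨h₀, rfl | rfl⟩ | ⟨h₀, rfl | ⟨h₁, rfl⟩ | ⟨h₁, rfl⟩⟩⟩
    · exact ⟨e / 2, isLink_iff.2 (by omega)⟩
    · exact ⟨M, isLink_iff.2 (by omega)⟩
    · by_cases h₁ : e / 2 + 1 = M
      · exact ⟨0, isLink_iff.2 (by omega)⟩
      · exact ⟨e / 2 + 1, isLink_iff.2 (by omega)⟩
    · exact ⟨e / 2, isLink_iff.2 (by omega)⟩
    · exact ⟨e / 2, isLink_iff.2 (by omega)⟩

theorem edgeSet_eq (M : ℕ) : (wheel (M + 1)).edgeSet = {e | e < 2 * M} := rfl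

theorem vertexSet_eq (M : ℕ) : (wheel (M + 1)).vertexSet = {v | v < M + 1} := rfl

theorem loopless {M : ℕ} (hM : 2 ≤ M) : (wheel (M + 1)).Loopless := by
  refine ⟨fun e x (h : (wheel (M + 1)).IsLink e x x) => ?_⟩
  rw [isLink_iff] at h
  omega

/-- The darts of a wheel, coded by the position of a rim vertex. -/
inductive Dart
  /-- The spoke at the given position, seen from the hub. -/
  | hub (p : ℕ)
  /-- The spoke at the given position, seen from the rim. -/
  | spoke (p : ℕ)
  /-- The rim edge to the next position. -/
  | right (p : ℕ)
  /-- The rim edge to the previous position. -/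
  | left (p : ℕ)

/-- The rim vertex at position `p`, where the rim is read from the vertex after `i` onwards, so that
`i` itself has the last position. -/
def pos (M i p : ℕ) : ℕ := if i + 1 + p < M then i + 1 + p else i + 1 + p - M

/-- The rim vertex before `j`. -/
def prev (M j : ℕ) : ℕ := if j = 0 then M - 1 else j - 1

/-- The dart of the wheel that belongs to a code. -/
def Dart.decode (M i : ℕ) : Dart → ℕ × ℕ
  | .hub p => (M, 2 * pos M i p)
  | .spoke p => (pos M i p, 2 * pos M i p)
  | .right p => (pos M i p, 2 * pos M i p + 1)
  | .left p => (pos M i p, 2 * prev M (pos M i p) + 1)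

/-- The position of a code. -/
def Dart.position : Dart → ℕ
  | .hub p => p
  | .spoke p => p
  | .right p => p
  | .left p => p

/-- The code of the other dart of the same edge. -/
def Dart.rev (M : ℕ) : Dart → Dart
  | .hub p => .spoke p
  | .spoke p => .hub p
  | .right p => .left (if p + 1 = M then 0 else p + 1)
  | .left p => .right (if p = 0 then M - 1 else p - 1)

variable {M i : ℕ}

theorem pos_spec (hi : i < M) {p : ℕ} (hp : p < M) : pos M i p < M ∧
    (pos M i p = i + 1 + p ∨ pos M i p + M = i + 1 + p) := by
  unfold pos; split_ifs <;> omega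

theorem exists_pos (hi : i < M) {j : ℕ} (hj : j < M) : ∃ p < M, pos M i p = j := by
  refine ⟨if i < j then j - i - 1 else j + M - i - 1, ?_, ?_⟩
  · split_ifs <;> omega
  · unfold pos; split_ifs <;> omega

theorem prev_spec (hM : 2 ≤ M) {j : ℕ} (hj : j < M) : prev M j < M ∧
    (j = 0 ∧ prev M j + 1 = M ∨ prev M j + 1 = j) := by
  unfold prev; split_ifs <;> omega

theorem injOn_decode (hM : 3 ≤ M) (hi : i < M) :
    Set.InjOn (Dart.decode M i) {d | d.position < M} := by
  intro d hd d' hd' h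
  cases d with | _ p =>
  all_goals
    cases d' with | _ q =>
    all_goals
      have hp : p < M := hd
      have hq : q < M := hd'
      have h₁ := pos_spec hi hp
      have h₂ := pos_spec hi hq
      have h₃ := prev_spec (by omega) h₁.1
      have h₄ := prev_spec (by omega) h₂.1
      have h₅ := Prod.ext_iff.1 h
      simp only [Dart.decode] at h₅
      first
        | (exfalso; omega)
        | (congr 1; omega)

theorem mem_darts_iff (hM : 3 ≤ M) (hi : i < M) (d : ℕ × ℕ) :
    d ∈ (wheel (M + 1)).darts ↔ ∃ p ∈ {d : Dart | d.position < M}, p.decode M i = d := by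
  obtain ⟨v, e⟩ := d
  change (wheel (M + 1)).Inc e v ↔ _
  rw [inc_iff]
  constructor
  · rintro ⟨he, ⟨h₀, h | h⟩ | ⟨h₁, h | h⟩⟩
    · obtain ⟨p, hp, h'⟩ := exists_pos hi (show e / 2 < M by omega)
      exact ⟨.hub p, hp, Prod.ext h.symm (by change 2 * pos M i p = e; omega)⟩
    · obtain ⟨p, hp, h'⟩ := exists_pos hi (show e / 2 < M by omega)
      exact ⟨.spoke p, hp, Prod.ext (h'.trans h.symm) (by change 2 * pos M i p = e; omega)⟩
    · obtain ⟨p, hp, h'⟩ := exists_pos hi (show e / 2 < M by omega)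
      exact ⟨.right p, hp, Prod.ext (h'.trans h.symm) (by change 2 * pos M i p + 1 = e; omega)⟩
    · have hv : v < M := by omega
      obtain ⟨p, hp, h'⟩ := exists_pos hi hv
      refine ⟨.left p, hp, Prod.ext h' ?_⟩
      change 2 * prev M (pos M i p) + 1 = e
      have := prev_spec (by omega) hv
      rw [h']
      omega
  · rintro ⟨d, hd, h⟩
    cases d with | _ p =>
    all_goals
      have hp : p < M := hd
      have h₁ := pos_spec hi hp
      have h₂ := prev_spec (by omega) h₁.1
      have h₃ := Prod.ext_iff.1 h
      simp only [Dart.decode] at h₃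
      omega

theorem isLink_spoke {j : ℕ} (hj : j < M) : (wheel (M + 1)).IsLink (2 * j) M j :=
  isLink_iff.2 ⟨by omega, Or.inl ⟨by omega, Or.inl ⟨rfl, by omega⟩⟩⟩

theorem isLink_rim {p q : ℕ} (hi : i < M) (hp : p < M) (hq : q < M)
    (h : p + 1 = q ∨ p + 1 = M ∧ q = 0) :
    (wheel (M + 1)).IsLink (2 * pos M i p + 1) (pos M i p) (pos M i q) := by
  have h₁ := pos_spec hi hp
  have h₂ := pos_spec hi hq
  have h₃ : pos M i q = pos M i p + 1 ∨ pos M i p + 1 = M ∧ pos M i q = 0 := by omega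
  rw [isLink_iff]
  rw [show (2 * pos M i p + 1) % 2 = 1 by omega, show (2 * pos M i p + 1) / 2 = pos M i p by omega]
  refine ⟨by omega, Or.inr ?_⟩
  rcases h₃ with h₃ | h₃
  · exact Or.inr ⟨rfl, by omega, Or.inl ⟨rfl, h₃⟩⟩
  · exact Or.inl ⟨rfl, h₃.1, Or.inl ⟨rfl, h₃.2⟩⟩

theorem prev_pos {p q : ℕ} (hi : i < M) (hp : p < M) (hq : q < M)
    (h : p + 1 = q ∨ p + 1 = M ∧ q = 0) : prev M (pos M i q) = pos M i p := by
  have h₁ := pos_spec hi hp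
  have h₂ := pos_spec hi hq
  unfold prev
  split_ifs <;> omega

theorem rev_spec (hi : i < M) (d : Dart) (hd : d.position < M) :
    (d.rev M).position < M ∧ ((d.rev M).decode M i).2 = (d.decode M i).2 ∧
      (wheel (M + 1)).IsLink (d.decode M i).2 (d.decode M i).1 ((d.rev M).decode M i).1 := by
  cases d with
  | hub p => exact ⟨hd, rfl, isLink_spoke (pos_spec hi hd).1⟩
  | spoke p => exact ⟨hd, rfl, (isLink_spoke (pos_spec hi hd).1).symm⟩
  | right p =>
    have hp : p < M := hd
    have hq : (if p + 1 = M then 0 else p + 1) < M := by split_ifs <;> omega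
    have h : p + 1 = (if p + 1 = M then 0 else p + 1) ∨
      p + 1 = M ∧ (if p + 1 = M then 0 else p + 1) = 0 := by split_ifs <;> omega
    refine ⟨hq, ?_, isLink_rim hi hp hq h⟩
    change 2 * prev M (pos M i _) + 1 = 2 * pos M i p + 1
    rw [prev_pos hi hp hq h]
  | left p =>
    have hp : p < M := hd
    have hq : (if p = 0 then M - 1 else p - 1) < M := by split_ifs <;> omega
    have h : (if p = 0 then M - 1 else p - 1) + 1 = p ∨
      (if p = 0 then M - 1 else p - 1) + 1 = M ∧ p = 0 := by split_ifs <;> omega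
    refine ⟨hq, ?_, ?_⟩
    · change 2 * pos M i _ + 1 = 2 * prev M (pos M i p) + 1
      rw [prev_pos hi hq hp h]
    · change (wheel (M + 1)).IsLink (2 * prev M (pos M i p) + 1) (pos M i p) (pos M i _)
      rw [prev_pos hi hq hp h]
      exact (isLink_rim hi hq hp h).symm

/-- The circular orders of the planar drawing of the wheel with the hub in the middle. -/
def next (M : ℕ) : Dart → Dart
  | .hub p => .hub (if p = 0 then M - 1 else p - 1)
  | .spoke p => .right p
  | .right p => .left p
  | .left p => .spoke p

/-- The faces of the drawing `Wheel.next`: the triangles and the outer face. -/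
def face (M : ℕ) : Dart → ℕ
  | .hub p => p
  | .spoke p => if p = 0 then M - 1 else p - 1
  | .right p => p
  | .left _ => M

theorem isPlanar (hM : 3 ≤ M) : (wheel (M + 1)).IsPlanar := by
  have hM' : M - 1 < M := by omega
  have hκ : ∀ v ∈ (wheel (M + 1)).vertexSet, v ≠ M →
      ∃ u, (wheel (M + 1)).Adj v u ∧ M - u < M - v := by
    intro v hv hne
    have hv' : v < M + 1 := hv
    have hv'' : v < M := by omega
    exact ⟨M, ⟨2 * v, (isLink_spoke hv'').symm⟩, by omega⟩
  refine (exists_planeGraph (G := wheel (M + 1)) (N := M + 1) (root := M)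
    (Set.finite_lt_nat _) (Set.finite_lt_nat _) (loopless (by omega)) (fun v => M - v)
    hκ (P := {d | d.position < M}) (Dart.decode M (M - 1)) (injOn_decode hM hM')
    (mem_darts_iff hM hM') (next M) (Dart.rev M) ?_ ?_
    (fun | .hub p => p | .spoke _ => 0 | .right _ => 2 | .left _ => 1) ?_ ?_
    (fun d hd => rev_spec hM' d hd) (face M) ?_ ?_ ?_).imp fun H h => h.1
  · intro d hd
    cases d with | _ p =>
    all_goals
      have hp : p < M := hd
      refine ⟨?_, rfl⟩
      simp only [next, Set.mem_ofPred_eq, Dart.position] at *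
      try split_ifs
      all_goals omega
  · intro d hd d' hd' h
    cases d with | _ p =>
    all_goals
      cases d' with | _ q =>
      all_goals
        have hp : p < M := hd
        have hq : q < M := hd'
        simp only [next, Dart.hub.injEq, Dart.spoke.injEq, Dart.right.injEq, Dart.left.injEq,
          reduceCtorEq] at h ⊢
        try split_ifs at h
        all_goals omega
  · intro d hd h₀
    cases d with | _ p =>
    all_goals
      simp only [next] at h₀ ⊢
      try split_ifs
      all_goals omega
  · intro d hd d' hd' h h' hv
    cases d with | _ p =>
    all_goals
      cases d' with | _ q =>
      all_goals
        have h₁ := pos_spec hM' (show p < M from hd)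
        have h₂ := pos_spec hM' (show q < M from hd')
        simp only [Dart.decode, Dart.hub.injEq, Dart.spoke.injEq, reduceCtorEq] at h h' hv ⊢
        try omega
  · intro d hd
    cases d with | _ p =>
    all_goals
      have hp : p < M := hd
      simp only [Dart.rev]
      try split_ifs
      all_goals
        simp only [next, face]
        try split_ifs
        all_goals first | omega | contradiction
  · intro q hq
    rcases Nat.lt_succ_iff_lt_or_eq.1 hq with h | h
    · exact ⟨.hub q, h, rfl⟩
    · subst h; exact ⟨.left 0, show 0 < q by omega, rfl⟩
  · rw [edgeSet_eq, vertexSet_eq, ncard_lt_nat, ncard_lt_nat]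
    omega

/-- The codes of the darts that remain when the rim edge at the last position is deleted. -/
def Dart.IsFan (M : ℕ) : Dart → Prop
  | .hub p => p < M
  | .spoke p => p < M
  | .right p => p + 1 < M
  | .left p => 0 < p ∧ p < M

/-- The circular orders of the drawing of the fan with all rim vertices on a line and
the hub at infinity, the spokes going up at even positions and down at odd positions. -/
def fanNext (M : ℕ) : Dart → Dart
  | .hub p => .hub (if p = 0 then 1 else if p % 2 = 0 then p - 2 else
      if p + 2 < M then p + 2 else if p + 2 = M then p + 1 else p - 1)
  | .spoke p => if p = 0 then .right p else if p + 1 = M then .left p else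
      if p % 2 = 0 then .right p else .left p
  | .right p => if p = 0 then .spoke p else if p % 2 = 0 then .left p else .spoke p
  | .left p => if p + 1 = M then .spoke p else if p % 2 = 0 then .spoke p else .right p

/-- The faces of the drawing `Wheel.fanNext`, numbered by the dart at the hub. -/
def fanFace (M : ℕ) : Dart → ℕ
  | .hub p => p
  | .spoke p => if p = 0 then 1 else if p % 2 = 0 then p - 2 else
      if p + 2 < M then p + 2 else if p + 2 = M then p + 1 else p - 1
  | .right p => if p % 2 = 0 then p else p - 1
  | .left p => if p % 2 = 1 then p else if p + 1 < M then p + 1 else p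

theorem isFan_iff (hM : 3 ≤ M) (hi : i < M) (d : Dart) :
    d.IsFan M ↔ d.position < M ∧ (d.decode M i).2 ≠ 2 * i + 1 := by
  cases d with
  | hub p => exact ⟨fun h => ⟨h, by change 2 * pos M i p ≠ _; omega⟩, fun h => h.1⟩
  | spoke p => exact ⟨fun h => ⟨h, by change 2 * pos M i p ≠ _; omega⟩, fun h => h.1⟩
  | right p =>
    change p + 1 < M ↔ p < M ∧ 2 * pos M i p + 1 ≠ 2 * i + 1
    refine ⟨fun h => ?_, fun h => ?_⟩
    · have := pos_spec hi (show p < M by omega)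
      omega
    · have := pos_spec hi h.1
      omega
  | left p =>
    change 0 < p ∧ p < M ↔ p < M ∧ 2 * prev M (pos M i p) + 1 ≠ 2 * i + 1
    refine ⟨fun h => ?_, fun h => ?_⟩
    · have h₁ := pos_spec hi h.2
      have h₂ := prev_spec (by omega) h₁.1
      omega
    · have h₁ := pos_spec hi h.1
      have h₂ := prev_spec (by omega) h₁.1
      omega

/-- The fan, a wheel without one rim edge, has a plane embedding in which adjacent rim vertices have
opposite orientations. -/
theorem exists_fan (hM : 4 ≤ M) (hi : i < M) :
    ∃ H : PlaneGraph ℕ ℕ, H.graph = (wheel (M + 1)).deleteEdges {2 * i + 1} ∧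
      ∀ d : Dart, d.IsFan M → H.rot (d.decode M i) = (fanNext M d).decode M i := by
  have hM' : 3 ≤ M := by omega
  have hκ : ∀ v ∈ ((wheel (M + 1)).deleteEdges {2 * i + 1}).vertexSet, v ≠ M →
      ∃ u, ((wheel (M + 1)).deleteEdges {2 * i + 1}).Adj v u ∧ M - u < M - v := by
    intro v hv hne
    have hv' : v < M + 1 := hv
    have hv'' : v < M := by omega
    exact ⟨M, ⟨2 * v, (isLink_spoke hv'').symm, fun h => by
      have : 2 * v = 2 * i + 1 := h
      omega⟩, by omega⟩
  have hsub : {d : Dart | d.IsFan M} ⊆ {d | d.position < M} := fun d hd =>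
    ((isFan_iff hM' hi d).1 hd).1
  refine exists_planeGraph (G := (wheel (M + 1)).deleteEdges {2 * i + 1}) (N := M) (root := M)
    (Set.finite_lt_nat _) ((Set.finite_lt_nat (2 * M)).subset fun e he => he.1)
    ⟨fun e x h => (loopless (M := M) (by omega)).not_isLoopAt e x h.1⟩ (fun v => M - v)
    hκ (P := {d : Dart | d.IsFan M}) (Dart.decode M i)
    ((injOn_decode hM' hi).mono hsub) ?_ (fanNext M)
    (Dart.rev M) ?_ ?_
    (fun | .hub p => if p % 2 = 0 then p else 2 * M - p | .spoke _ => 0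
         | .right p => if p % 2 = 0 then 2 else 1 | .left p => if p % 2 = 0 then 1 else 2) ?_ ?_
    ?_ (fanFace M) ?_ ?_ ?_
  · intro d
    refine (Graph.deleteEdges_inc (G := wheel (M + 1))).trans ?_
    constructor
    · rintro ⟨h₁, h₂⟩
      obtain ⟨p, hp, rfl⟩ := (mem_darts_iff hM' hi d).1 h₁
      exact ⟨p, (isFan_iff hM' hi p).2 ⟨hp, h₂⟩, rfl⟩
    · rintro ⟨p, hp, rfl⟩
      have h := (isFan_iff hM' hi p).1 hp
      exact ⟨(mem_darts_iff hM' hi _).2 ⟨p, h.1, rfl⟩, h.2⟩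
  · intro d hd
    cases d with | _ p =>
    all_goals
      simp only [Set.mem_ofPred_eq, Dart.IsFan] at hd
      simp only [fanNext]
      split_ifs
      all_goals
        simp only [Set.mem_ofPred_eq, Dart.IsFan, Dart.decode, and_true]
        omega
  · intro d hd d' hd' h
    cases d with | _ p =>
    all_goals
      cases d' with | _ q =>
      all_goals
        simp only [Set.mem_ofPred_eq, Dart.IsFan] at hd hd'
        simp only [fanNext] at h
        split_ifs at h
        all_goals
          simp only [Dart.hub.injEq, Dart.spoke.injEq, Dart.right.injEq, Dart.left.injEq,
            reduceCtorEq] at h ⊢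
          try omega
  · intro d hd h₀
    cases d with | _ p =>
    all_goals
      simp only [Set.mem_ofPred_eq, Dart.IsFan] at hd
      simp only [fanNext] at h₀ ⊢
      split_ifs at h₀ ⊢
      all_goals
        try simp only
        try split_ifs
        all_goals omega
  · intro d hd d' hd' h h' hv
    cases d with | _ p =>
    all_goals
      cases d' with | _ q =>
      all_goals
        simp only [Set.mem_ofPred_eq, Dart.IsFan] at hd hd'
        have h₁ := pos_spec hi (show p < M by omega)
        have h₂ := pos_spec hi (show q < M by omega)
        simp only [Dart.decode, Dart.hub.injEq, Dart.spoke.injEq, reduceCtorEq] at h h' hv ⊢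
        try split_ifs at h h'
        all_goals try omega
  · intro d hd
    have h := (isFan_iff hM' hi d).1 hd
    obtain ⟨h₁, h₂, h₃⟩ := rev_spec hi d h.1
    exact ⟨(isFan_iff hM' hi _).2 ⟨h₁, h₂ ▸ h.2⟩, h₂, h₃, h.2⟩
  · intro d hd
    cases d with | _ p =>
    all_goals
      simp only [Set.mem_ofPred_eq, Dart.IsFan] at hd
      simp only [Dart.rev]
      try split_ifs
      all_goals
        simp only [fanNext]
        split_ifs
        all_goals
          simp only [fanFace]
          try split_ifs
          all_goals first | omega | contradiction
  · exact fun q hq => ⟨.hub q, hq, rfl⟩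
  · have h₁ : ((wheel (M + 1)).deleteEdges {2 * i + 1}).edgeSet =
        (wheel (M + 1)).edgeSet \ {2 * i + 1} := rfl
    have h₂ : 2 * i + 1 ∈ (wheel (M + 1)).edgeSet := show 2 * i + 1 < 2 * M by omega
    rw [h₁, Set.ncard_sdiff_singleton_of_mem h₂, edgeSet_eq, Graph.vertexSet_deleteEdges,
      vertexSet_eq, ncard_lt_nat, ncard_lt_nat]
    omega

/-- The edges at the rim vertex at a position between the first and the last one. -/
theorem inc_pos_iff (hi : i < M) {p e : ℕ} (hp : p + 1 < M) :
    (wheel (M + 1)).Inc e (pos M i (p + 1)) ↔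
      e = 2 * pos M i p + 1 ∨ e = 2 * pos M i (p + 1) ∨ e = 2 * pos M i (p + 1) + 1 := by
  have h₁ := pos_spec hi hp
  have h₂ := pos_spec hi (show p < M by omega)
  rw [inc_iff]
  omega

theorem isTriad (hi : i < M) {p : ℕ} (hp : p + 1 < M) {H : PlaneGraph ℕ ℕ}
    (hH : ∀ e, H.graph.Inc e (pos M i (p + 1)) ↔ (wheel (M + 1)).Inc e (pos M i (p + 1))) :
    H.IsTriad (pos M i (p + 1)) (2 * pos M i p + 1) (2 * pos M i (p + 1))
      (2 * pos M i (p + 1) + 1) := by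
  have h₁ := pos_spec hi hp
  have h₂ := pos_spec hi (show p < M by omega)
  exact ⟨by omega, by omega, by omega, fun e => (hH e).trans (inc_pos_iff hi hp)⟩

/-- In every embedding of a wheel, the rim vertices have the same orientation: all spokes leave the
rim on the side of the hub. -/
theorem sameOrientation (hi : i < M) {p : ℕ} (hp : p + 2 < M) {H : PlaneGraph ℕ ℕ}
    (hH : H.graph = wheel (M + 1)) :
    H.SameOrientation (pos M i (p + 1)) (pos M i (p + 2)) (2 * pos M i p + 1)
      (2 * pos M i (p + 1)) (2 * pos M i (p + 1) + 1) (2 * pos M i (p + 2))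
      (2 * pos M i (p + 2) + 1) := by
  obtain ⟨side, hside⟩ := H.exists_sides {e | e % 2 = 1} (by
    intro v
    rw [hH]
    simp only [Set.mem_ofPred_eq, inc_iff]
    by_cases hv : v < M
    · have h := prev_spec (by omega) hv
      have : {e | e % 2 = 1 ∧ e < 2 * M ∧ (e % 2 = 0 ∧ (v = M ∨ v = e / 2) ∨ e % 2 = 1 ∧
          (v = e / 2 ∨ e / 2 + 1 = M ∧ v = 0 ∨ e / 2 + 1 < M ∧ v = e / 2 + 1))} =
          {2 * v + 1, 2 * prev M v + 1} := by
        ext e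
        simp only [Set.mem_ofPred_eq, Set.mem_insert_iff, Set.mem_singleton_iff]
        omega
      rw [this, Set.ncard_pair (by omega)]
      exact even_two
    · exact even_ncard_of_forall_notMem fun e he => by
        simp only [Set.mem_ofPred_eq] at he
        omega)
  have h₁ := pos_spec hi (show p + 1 < M by omega)
  have h₂ := pos_spec hi (show p + 2 < M by omega)
  have hspoke : ∀ {j}, j < M → H.graph.IsLink (2 * j) M j := fun hj => hH ▸ isLink_spoke hj
  have heven : ∀ {j : ℕ}, 2 * j ∉ {e | e % 2 = 1} := by
    intro j h
    simp only [Set.mem_ofPred_eq] at h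
    omega
  have hspoke_side : ∀ {j}, j < M → ((j, 2 * j) ∈ side ↔ (M, 2 * j) ∈ side) := by
    intro j hj
    rw [(hside _ _ _ (hspoke hj)).2, iff_true_right heven]
  refine PlaneGraph.sameOrientation_of_sides hside
    (isTriad hi (by omega) fun e => by rw [hH]) (isTriad hi (by omega) fun e => by rw [hH])
    (hH ▸ isLink_rim hi (by omega) (by omega) (Or.inl rfl))
    (show (2 * pos M i (p + 1) + 1) % 2 = 1 by omega) heven heven ?_
  rw [hspoke_side h₁.1, hspoke_side h₂.1]
  -- No edge at the hub belongs to the rim, so all darts at the hub are on the same side.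
  refine iff_of_eq (Graph.eq_of_rot_invariant H.finite_vertexSet H.finite_edgeSet
    H.rot_isCycleOn (fun d => d ∈ side) ?_ (hspoke h₁.1).inc_left (hspoke h₂.1).inc_left)
  rintro e ⟨w, h⟩
  have he : e ∉ {e | e % 2 = 1} := by
    rw [hH, isLink_iff] at h
    simp only [Set.mem_ofPred_eq]
    omega
  refine propext ?_
  rw [(hside _ _ _ h).1, (hside _ _ _ h).2, iff_true_right he]

/-- The flip-distance for the wheel and each of its rim edges. -/
theorem le_mul_flipDist (hM : 4 ≤ M) (hi : i < M) :
    ((M + 1 : ℕ) : ℕ∞) ≤ (8 : ℕ) *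
      flipDist (Emb ((wheel (M + 1)).deleteEdges {2 * i + 1})) (Emb (wheel (M + 1))) := by
  obtain ⟨H, hH, hrot⟩ := exists_fan hM hi
  have hE : 2 * i + 1 ∈ (wheel (M + 1)).edgeSet := show 2 * i + 1 < 2 * M by omega
  refine PlaneGraph.le_mul_flipDist (N := M - 3) (H := H) hH ?_
    (v := fun p => pos M i (p + 1)) ?_ (fun p => 2 * pos M i p + 1) (fun p => 2 * pos M i (p + 1))
    (fun p => 2 * pos M i (p + 1) + 1) (fun p => 2 * pos M i (p + 2))
    (fun p => 2 * pos M i (p + 2) + 1) ?_ ?_ ?_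
  · intro h
    have h' : 2 * i + 1 ∈ H.graph.edgeSet := by rw [show H.graph = wheel (M + 1) from h]; exact hE
    rw [hH] at h'
    exact h'.2 rfl
  · intro p hp q hq h
    simp only [Set.mem_ofPred_eq] at hp hq
    have h₁ := pos_spec hi (show p + 1 < M by omega)
    have h₂ := pos_spec hi (show q + 1 < M by omega)
    simp only at h
    omega
  · rintro p hp ⟨-, -, h⟩
    have hp₀ := pos_spec hi (show p < M by omega)
    have hp₁ := pos_spec hi (show p + 1 < M by omega)
    have hp₂ := pos_spec hi (show p + 2 < M by omega)
    have h₁ := hrot (.left (p + 1)) ⟨by omega, by omega⟩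
    have h₂ := hrot (.left (p + 2)) ⟨by omega, by omega⟩
    simp only [Dart.decode,
      prev_pos hi (show p < M by omega) (show p + 1 < M by omega) (Or.inl rfl),
      prev_pos hi (show p + 1 < M by omega) (show p + 2 < M by omega) (Or.inl rfl)] at h₁ h₂
    rw [h₁, h₂] at h
    rcases Nat.mod_two_eq_zero_or_one p with h₀ | h₀
    · have h₃ : fanNext M (.left (p + 1)) = .right (p + 1) := by
        simp only [fanNext]; rw [if_neg (by omega), if_neg (by omega)]
      have h₄ : fanNext M (.left (p + 2)) = .spoke (p + 2) := by
        simp only [fanNext]; rw [if_neg (by omega), if_pos (by omega)]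
      rw [h₃, h₄] at h
      have := (Prod.ext_iff.1 (h.2 rfl)).2
      simp only at this
      omega
    · have h₃ : fanNext M (.left (p + 1)) = .spoke (p + 1) := by
        simp only [fanNext]; rw [if_neg (by omega), if_pos (by omega)]
      have h₄ : fanNext M (.left (p + 2)) = .right (p + 2) := by
        simp only [fanNext]; rw [if_neg (by omega), if_neg (by omega)]
      rw [h₃, h₄] at h
      have := (Prod.ext_iff.1 (h.1 rfl)).2
      simp only at this
      omega
  · intro H' hH' p hp
    exact sameOrientation hi (by omega) hH'
  · intro m hm hmN
    omega

end Wheel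

/-! ### Cubic ladders -/

theorem Graph.map_deleteEdges_ofEnds_isLink {α α' β : Type*} {V : Set α} {E F : Set β}
    {ends : β → Sym2 α} (h : ∀ e ∈ E, ∀ x ∈ ends e, x ∈ V) (f : α → α') {e : β} {x y : α'} :
    (((Graph.ofEnds V E ends h).deleteEdges F).map f).IsLink e x y ↔
      (e ∈ E ∧ e ∉ F) ∧ (ends e).map f = s(x, y) := by
  constructor
  · rintro ⟨a, b, ⟨⟨he, hab⟩, hF⟩, rfl, rfl⟩
    exact ⟨⟨he, hF⟩, by rw [hab, Sym2.map_mk]⟩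
  · rintro ⟨⟨he, hF⟩, h⟩
    obtain ⟨a, b, hab⟩ : ∃ a b, ends e = s(a, b) := by
      induction ends e using Sym2.ind with
      | _ a b => exact ⟨a, b, rfl⟩
    rw [hab, Sym2.map_mk, Sym2.eq_iff] at h
    rcases h with ⟨rfl, rfl⟩ | ⟨rfl, rfl⟩
    · exact ⟨a, b, ⟨⟨he, hab⟩, hF⟩, rfl, rfl⟩
    · exact ⟨b, a, ⟨⟨he, hab.trans Sym2.eq_swap⟩, hF⟩, rfl, rfl⟩

namespace CubicLadder

variable {k : ℕ}

/-- The vertex `b_j`, where `b_0` and `b_(k-1)` are `a_0` and `a_(k-1)`. -/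
def bVertex (k j : ℕ) : ℕ := if j = 0 then 0 else if j + 1 = k then 2 * j else 2 * j + 1

theorem bVertex_spec (k j : ℕ) : j = 0 ∧ bVertex k j = 0 ∨ j ≠ 0 ∧ j + 1 = k ∧ bVertex k j = 2 * j ∨
    j ≠ 0 ∧ j + 1 ≠ k ∧ bVertex k j = 2 * j + 1 := by
  unfold bVertex; split_ifs <;> omega

/-- The vertex `a_j`, seen as the end of an edge from `a_(j-1)`. -/
def aVertex (k j : ℕ) : ℕ := if j = k then 0 else 2 * j

theorem aVertex_spec (k j : ℕ) : j = k ∧ aVertex k j = 0 ∨ j ≠ k ∧ aVertex k j = 2 * j := by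
  unfold aVertex; split_ifs <;> omega

/-- The links of the cubic ladder: rungs, edges between consecutive `a_j`, and edges between
consecutive `b_j`. -/
theorem isLink_iff (hk : 3 ≤ k) {e x y : ℕ} : (cubicLadder k).IsLink e x y ↔
    (∃ j, 0 < j ∧ j + 1 < k ∧ e = 3 * j ∧ s(2 * j, 2 * j + 1) = s(x, y)) ∨
    (∃ j, j < k ∧ e = 3 * j + 1 ∧ s(2 * j, aVertex k (j + 1)) = s(x, y)) ∨
    (∃ j, j + 1 < k ∧ e = 3 * j + 2 ∧ s(bVertex k j, bVertex k (j + 1)) = s(x, y)) := by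
  rw [cubicLadder, circularLadder, Graph.map_deleteEdges_ofEnds_isLink]
  have hE : (e ∈ {d | d < 3 * k} ∧ e ∉ ({0, 3 * (k - 1), 3 * (k - 1) + 2} : Set ℕ)) ↔
      (∃ j, 0 < j ∧ j + 1 < k ∧ e = 3 * j) ∨ (∃ j, j < k ∧ e = 3 * j + 1) ∨
        ∃ j, j + 1 < k ∧ e = 3 * j + 2 := by
    simp only [Set.mem_ofPred_eq, Set.mem_insert_iff, Set.mem_singleton_iff, not_or]
    constructor
    · rintro ⟨h₁, h₂, h₃, h₄⟩
      have h : e % 3 = 0 ∨ e % 3 = 1 ∨ e % 3 = 2 := by omega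
      rcases h with h | h | h
      · exact Or.inl ⟨e / 3, by omega⟩
      · exact Or.inr (Or.inl ⟨e / 3, by omega⟩)
      · exact Or.inr (Or.inr ⟨e / 3, by omega⟩)
    · rintro (⟨j, h⟩ | ⟨j, h⟩ | ⟨j, h⟩) <;> omega
  rw [hE, or_and_right, or_and_right]
  simp only [← exists_and_right, and_assoc]
  refine or_congr (exists_congr fun j => ?_) (or_congr (exists_congr fun j => ?_)
    (exists_congr fun j => ?_))
  · refine and_congr_right fun h₁ => and_congr_right fun h₂ => and_congr_right ?_
    rintro rfl
    rw [if_pos (by omega), show 3 * j / 3 = j by omega, Sym2.map_mk, if_neg (by omega),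
      if_neg (by omega), if_neg (by omega), if_neg (by omega)]
  · refine and_congr_right fun h₁ => and_congr_right ?_
    rintro rfl
    rw [if_neg (by omega), if_pos (by omega), show (3 * j + 1) / 3 = j by omega, Sym2.map_mk,
      succ_mod_eq h₁, if_neg (by omega), if_neg (by omega)]
    have := aVertex_spec k (j + 1)
    split_ifs <;> first | omega | (congr! 2; omega)
  · refine and_congr_right fun h₁ => and_congr_right ?_
    rintro rfl
    rw [if_neg (by omega), if_neg (by omega), show (3 * j + 2) / 3 = j by omega, Sym2.map_mk,
      succ_mod_eq (by omega), if_neg (show ¬ j + 1 = k by omega)]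
    have h₁ : ∀ i, i < k → (if 2 * i + 1 = 1 then 0 else if 2 * i + 1 = 2 * (k - 1) + 1 then
        2 * (k - 1) else 2 * i + 1) = bVertex k i := by
      intro i hi
      unfold bVertex
      split_ifs <;> omega
    rw [h₁ j (by omega), h₁ (j + 1) (by omega)]

theorem isLink_rung {j : ℕ} (h₀ : 0 < j) (h₁ : j + 1 < k) :
    (cubicLadder k).IsLink (3 * j) (2 * j) (2 * j + 1) :=
  (isLink_iff (by omega)).2 (Or.inl ⟨j, h₀, h₁, rfl, rfl⟩)

theorem isLink_a (hk : 3 ≤ k) {j : ℕ} (h : j < k) :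
    (cubicLadder k).IsLink (3 * j + 1) (2 * j) (aVertex k (j + 1)) :=
  (isLink_iff hk).2 (Or.inr (Or.inl ⟨j, h, rfl, rfl⟩))

theorem isLink_b (hk : 3 ≤ k) {j : ℕ} (h : j + 1 < k) :
    (cubicLadder k).IsLink (3 * j + 2) (bVertex k j) (bVertex k (j + 1)) :=
  (isLink_iff hk).2 (Or.inr (Or.inr ⟨j, h, rfl, rfl⟩))

theorem inc_iff (hk : 3 ≤ k) {e x : ℕ} : (cubicLadder k).Inc e x ↔
    (∃ j, 0 < j ∧ j + 1 < k ∧ e = 3 * j ∧ (x = 2 * j ∨ x = 2 * j + 1)) ∨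
    (∃ j, j < k ∧ e = 3 * j + 1 ∧ (x = 2 * j ∨ x = aVertex k (j + 1))) ∨
    (∃ j, j + 1 < k ∧ e = 3 * j + 2 ∧ (x = bVertex k j ∨ x = bVertex k (j + 1))) := by
  have key : ∀ {a b : ℕ}, (∃ y, s(a, b) = s(x, y)) ↔ x = a ∨ x = b := by
    intro a b
    simp only [Sym2.eq_iff]
    constructor
    · rintro ⟨y, ⟨rfl, rfl⟩ | ⟨rfl, rfl⟩⟩ <;> simp
    · rintro (rfl | rfl)
      · exact ⟨b, Or.inl ⟨rfl, rfl⟩⟩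
      · exact ⟨a, Or.inr ⟨rfl, rfl⟩⟩
  simp only [Graph.Inc, isLink_iff hk, ← key]
  constructor
  · rintro ⟨y, ⟨j, h₁, h₂, h₃, h⟩ | ⟨j, h₁, h₂, h⟩ | ⟨j, h₁, h₂, h⟩⟩
    exacts [Or.inl ⟨j, h₁, h₂, h₃, y, h⟩, Or.inr (Or.inl ⟨j, h₁, h₂, y, h⟩),
      Or.inr (Or.inr ⟨j, h₁, h₂, y, h⟩)]
  · rintro (⟨j, h₁, h₂, h₃, y, h⟩ | ⟨j, h₁, h₂, y, h⟩ | ⟨j, h₁, h₂, y, h⟩)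
    exacts [⟨y, Or.inl ⟨j, h₁, h₂, h₃, h⟩⟩, ⟨y, Or.inr (Or.inl ⟨j, h₁, h₂, h⟩)⟩,
      ⟨y, Or.inr (Or.inr ⟨j, h₁, h₂, h⟩)⟩]

theorem mem_edgeSet_iff {e : ℕ} : e ∈ (cubicLadder k).edgeSet ↔
    e < 3 * k ∧ e ≠ 0 ∧ e ≠ 3 * (k - 1) ∧ e ≠ 3 * (k - 1) + 2 := by
  change (e < 3 * k ∧ e ∉ ({0, 3 * (k - 1), 3 * (k - 1) + 2} : Set ℕ)) ↔ _
  simp only [Set.mem_insert_iff, Set.mem_singleton_iff, not_or, ne_eq]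

theorem mem_vertexSet_iff {v : ℕ} : v ∈ (cubicLadder k).vertexSet ↔
    v < 2 * k ∧ v ≠ 1 ∧ v ≠ 2 * (k - 1) + 1 := by
  change (∃ u, u < 2 * k ∧
    (if u = 1 then 0 else if u = 2 * (k - 1) + 1 then 2 * (k - 1) else u) = v) ↔ _
  constructor
  · rintro ⟨u, hu, rfl⟩
    split_ifs <;> omega
  · rintro ⟨h₁, h₂, h₃⟩
    exact ⟨v, h₁, by rw [if_neg h₂, if_neg h₃]⟩

theorem finite_vertexSet (k : ℕ) : (cubicLadder k).vertexSet.Finite :=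
  (Set.finite_lt_nat (2 * k)).subset fun _ hv => ((mem_vertexSet_iff).1 hv).1

theorem finite_edgeSet (k : ℕ) : (cubicLadder k).edgeSet.Finite :=
  (Set.finite_lt_nat (3 * k)).subset fun _ he => ((mem_edgeSet_iff).1 he).1

theorem ncard_vertexSet (hk : 3 ≤ k) : (cubicLadder k).vertexSet.ncard = 2 * k - 2 := by
  have h : (cubicLadder k).vertexSet =
      ((((Finset.range (2 * k)).erase 1).erase (2 * (k - 1) + 1) : Finset ℕ) : Set ℕ) := by
    ext v
    rw [mem_vertexSet_iff]
    simp only [Finset.coe_erase, Finset.coe_range, Set.mem_sdiff, Set.mem_singleton_iff,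
      Set.mem_Iio]
    tauto
  rw [h, Set.ncard_coe_finset, Finset.card_erase_of_mem, Finset.card_erase_of_mem,
    Finset.card_range]
  · omega
  · rw [Finset.mem_range]; omega
  · rw [Finset.mem_erase, Finset.mem_range]; omega

theorem ncard_edgeSet (hk : 3 ≤ k) : (cubicLadder k).edgeSet.ncard = 3 * k - 3 := by
  have h : (cubicLadder k).edgeSet = ((((Finset.range (3 * k)).erase 0).erase
      (3 * (k - 1))).erase (3 * (k - 1) + 2) : Finset ℕ) := by
    ext v
    rw [mem_edgeSet_iff]
    simp only [Finset.coe_erase, Finset.coe_range, Set.mem_sdiff, Set.mem_singleton_iff,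
      Set.mem_Iio]
    tauto
  rw [h, Set.ncard_coe_finset, Finset.card_erase_of_mem, Finset.card_erase_of_mem,
    Finset.card_erase_of_mem, Finset.card_range]
  · omega
  · rw [Finset.mem_range]; omega
  · rw [Finset.mem_erase, Finset.mem_range]; omega
  · rw [Finset.mem_erase, Finset.mem_erase, Finset.mem_range]; omega

theorem loopless (hk : 3 ≤ k) : (cubicLadder k).Loopless := by
  refine ⟨fun e x (h : (cubicLadder k).IsLink e x x) => ?_⟩
  rw [isLink_iff hk] at h
  simp only [Sym2.eq_iff, or_self] at h
  rcases h with ⟨j, h⟩ | ⟨j, h⟩ | ⟨j, h⟩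
  · omega
  · have := aVertex_spec k (j + 1)
    omega
  · have := bVertex_spec k j
    have := bVertex_spec k (j + 1)
    omega

/-- The edges at `a_(j+1)`, if it is an end of a rung. -/
theorem inc_a_iff {j e : ℕ} (h : j + 2 < k) : (cubicLadder k).Inc e (2 * (j + 1)) ↔
    e = 3 * j + 1 ∨ e = 3 * (j + 1) ∨ e = 3 * (j + 1) + 1 := by
  rw [inc_iff (by omega)]
  constructor
  · rintro (⟨i, hi⟩ | ⟨i, hi⟩ | ⟨i, hi⟩)
    · omega
    · have := aVertex_spec k (i + 1)
      omega
    · have := bVertex_spec k i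
      have := bVertex_spec k (i + 1)
      omega
  · rintro (rfl | rfl | rfl)
    · have := aVertex_spec k (j + 1)
      exact Or.inr (Or.inl ⟨j, by omega⟩)
    · exact Or.inl ⟨j + 1, by omega⟩
    · exact Or.inr (Or.inl ⟨j + 1, by omega⟩)

/-- The edges at `b_(j+1)`, if it is an end of a rung. -/
theorem inc_b_iff {j e : ℕ} (h : j + 2 < k) : (cubicLadder k).Inc e (2 * (j + 1) + 1) ↔
    e = 3 * j + 2 ∨ e = 3 * (j + 1) ∨ e = 3 * (j + 1) + 2 := by
  rw [inc_iff (by omega)]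
  constructor
  · rintro (⟨i, hi⟩ | ⟨i, hi⟩ | ⟨i, hi⟩)
    · omega
    · have := aVertex_spec k (i + 1)
      omega
    · have := bVertex_spec k i
      have := bVertex_spec k (i + 1)
      omega
  · have := bVertex_spec k (j + 1)
    rintro (rfl | rfl | rfl)
    · exact Or.inr (Or.inr ⟨j, by omega⟩)
    · exact Or.inl ⟨j + 1, by omega⟩
    · exact Or.inr (Or.inr ⟨j + 1, by omega⟩)

theorem inc_zero_iff (hk : 3 ≤ k) {e : ℕ} : (cubicLadder k).Inc e 0 ↔
    e = 1 ∨ e = 2 ∨ e = 3 * (k - 1) + 1 := by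
  rw [inc_iff hk]
  constructor
  · rintro (⟨i, hi⟩ | ⟨i, hi⟩ | ⟨i, hi⟩)
    · omega
    · have := aVertex_spec k (i + 1)
      omega
    · have := bVertex_spec k i
      have := bVertex_spec k (i + 1)
      omega
  · rintro (rfl | rfl | rfl)
    · exact Or.inr (Or.inl ⟨0, by omega⟩)
    · have := bVertex_spec k 0
      exact Or.inr (Or.inr ⟨0, by omega⟩)
    · have := aVertex_spec k (k - 1 + 1)
      exact Or.inr (Or.inl ⟨k - 1, by omega⟩)

theorem inc_last_iff (hk : 3 ≤ k) {e : ℕ} : (cubicLadder k).Inc e (2 * (k - 1)) ↔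
    e = 3 * (k - 2) + 1 ∨ e = 3 * (k - 2) + 2 ∨ e = 3 * (k - 1) + 1 := by
  rw [inc_iff hk]
  constructor
  · rintro (⟨i, hi⟩ | ⟨i, hi⟩ | ⟨i, hi⟩)
    · omega
    · have := aVertex_spec k (i + 1)
      omega
    · have := bVertex_spec k i
      have := bVertex_spec k (i + 1)
      omega
  · rintro (rfl | rfl | rfl)
    · have := aVertex_spec k (k - 2 + 1)
      exact Or.inr (Or.inl ⟨k - 2, by omega⟩)
    · have := bVertex_spec k (k - 2 + 1)
      exact Or.inr (Or.inr ⟨k - 2, by omega⟩)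
    · exact Or.inr (Or.inl ⟨k - 1, by omega⟩)

theorem cubic (hk : 3 ≤ k) {v : ℕ} (hv : v ∈ (cubicLadder k).vertexSet) :
    {e | (cubicLadder k).Inc e v}.ncard = 3 := by
  rw [mem_vertexSet_iff] at hv
  have h : v = 0 ∨ v = 2 * (k - 1) ∨ (∃ j, j + 2 < k ∧ v = 2 * (j + 1)) ∨
      ∃ j, j + 2 < k ∧ v = 2 * (j + 1) + 1 := by
    by_cases h₀ : v = 0
    · exact Or.inl h₀
    by_cases h₁ : v = 2 * (k - 1)
    · exact Or.inr (Or.inl h₁)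
    rcases Nat.mod_two_eq_zero_or_one v with h | h
    · exact Or.inr (Or.inr (Or.inl ⟨v / 2 - 1, by omega⟩))
    · exact Or.inr (Or.inr (Or.inr ⟨v / 2 - 1, by omega⟩))
  rw [Set.ncard_eq_three]
  rcases h with rfl | rfl | ⟨j, hj, rfl⟩ | ⟨j, hj, rfl⟩
  · exact ⟨1, 2, 3 * (k - 1) + 1, by omega, by omega, by omega, Set.ext fun e => inc_zero_iff hk⟩
  · exact ⟨_, _, _, by omega, by omega, by omega, Set.ext fun e => inc_last_iff hk⟩
  · exact ⟨_, _, _, by omega, by omega, by omega, Set.ext fun e => inc_a_iff hj⟩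
  · exact ⟨_, _, _, by omega, by omega, by omega, Set.ext fun e => inc_b_iff hj⟩

end CubicLadder

/-! ### Embeddings of cubic ladders -/

namespace CubicLadder

variable {k : ℕ}

/-- The darts of a cubic ladder, coded by the index of the vertex `a_j` or `b_j`. -/
inductive Dart
  /-- The edge from `a_j` to its successor. -/
  | aRight (j : ℕ)
  /-- The edge from `a_j` to its predecessor. -/
  | aLeft (j : ℕ)
  /-- The rung at `a_j`. -/
  | aRung (j : ℕ)
  /-- The edge from `b_j` to `b_(j+1)`. -/
  | bRight (j : ℕ)
  /-- The edge from `b_j` to `b_(j-1)`. -/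
  | bLeft (j : ℕ)
  /-- The rung at `b_j`. -/
  | bRung (j : ℕ)

/-- The codes of the darts of the cubic ladder. -/
def Dart.IsClosed (k : ℕ) : Dart → Prop
  | .aRight j => j < k
  | .aLeft j => j < k
  | .aRung j => 0 < j ∧ j + 1 < k
  | .bRight j => j + 1 < k
  | .bLeft j => 0 < j ∧ j < k
  | .bRung j => 0 < j ∧ j + 1 < k

/-- The codes of the darts that remain when the edge between `a_(k-1)` and `a_0` is deleted. -/
def Dart.IsOpen (k : ℕ) : Dart → Prop
  | .aRight j => j + 1 < k
  | .aLeft j => 0 < j ∧ j < k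
  | .aRung j => 0 < j ∧ j + 1 < k
  | .bRight j => j + 1 < k
  | .bLeft j => 0 < j ∧ j < k
  | .bRung j => 0 < j ∧ j + 1 < k

/-- The cyclic predecessor of `j`. -/
def prev (k j : ℕ) : ℕ := if j = 0 then k - 1 else j - 1

theorem prev_spec (k j : ℕ) : j = 0 ∧ prev k j = k - 1 ∨ j ≠ 0 ∧ prev k j = j - 1 := by
  unfold prev; split_ifs <;> omega

/-- The dart of the cubic ladder that belongs to a code. -/
def Dart.decode (k : ℕ) : Dart → ℕ × ℕ
  | .aRight j => (2 * j, 3 * j + 1)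
  | .aLeft j => (2 * j, 3 * prev k j + 1)
  | .aRung j => (2 * j, 3 * j)
  | .bRight j => (bVertex k j, 3 * j + 2)
  | .bLeft j => (bVertex k j, 3 * (j - 1) + 2)
  | .bRung j => (bVertex k j, 3 * j)

/-- The code of the other dart of the same edge. -/
def Dart.rev (k : ℕ) : Dart → Dart
  | .aRight j => .aLeft (if j + 1 = k then 0 else j + 1)
  | .aLeft j => .aRight (prev k j)
  | .aRung j => .bRung j
  | .bRight j => .bLeft (j + 1)
  | .bLeft j => .bRight (j - 1)
  | .bRung j => .aRung j

theorem injOn_decode (hk : 3 ≤ k) : Set.InjOn (Dart.decode k) {d | d.IsClosed k} := by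
  intro d hd d' hd' h
  cases d with | _ i =>
  all_goals
    cases d' with | _ j =>
    all_goals
      simp only [Set.mem_ofPred_eq, Dart.IsClosed] at hd hd'
      have h₅ := Prod.ext_iff.1 h
      simp only [Dart.decode] at h₅
      obtain ⟨h₆, h₇⟩ := h₅
      first
        | (exfalso; omega)
        | (congr 1; omega)
        | (have := prev_spec k i
           have := prev_spec k j
           have := bVertex_spec k i
           have := bVertex_spec k j
           exfalso
           omega)

theorem mem_darts_iff (hk : 3 ≤ k) (d : ℕ × ℕ) :
    d ∈ (cubicLadder k).darts ↔ ∃ p ∈ {d : Dart | d.IsClosed k}, p.decode k = d := by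
  obtain ⟨v, e⟩ := d
  change (cubicLadder k).Inc e v ↔ _
  rw [inc_iff hk]
  constructor
  · rintro (⟨j, h₀, h₁, rfl, rfl | rfl⟩ | ⟨j, h₁, rfl, rfl | rfl⟩ | ⟨j, h₁, rfl, rfl | rfl⟩)
    · exact ⟨.aRung j, ⟨h₀, h₁⟩, rfl⟩
    · refine ⟨.bRung j, ⟨h₀, h₁⟩, Prod.ext ?_ rfl⟩
      have := bVertex_spec k j
      simp only [Dart.decode]
      omega
    · exact ⟨.aRight j, h₁, rfl⟩
    · by_cases h : j + 1 = k
      · refine ⟨.aLeft 0, show 0 < k by omega, Prod.ext ?_ ?_⟩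
        · have := aVertex_spec k (j + 1)
          simp only [Dart.decode]
          omega
        · have := prev_spec k 0
          simp only [Dart.decode]
          omega
      · refine ⟨.aLeft (j + 1), show j + 1 < k by omega, Prod.ext ?_ ?_⟩
        · have := aVertex_spec k (j + 1)
          simp only [Dart.decode]
          omega
        · have := prev_spec k (j + 1)
          simp only [Dart.decode]
          omega
    · exact ⟨.bRight j, h₁, rfl⟩
    · exact ⟨.bLeft (j + 1), ⟨by omega, h₁⟩, rfl⟩
  · rintro ⟨d, hd, h⟩
    obtain ⟨rfl, rfl⟩ := Prod.ext_iff.1 h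
    cases d with
    | aRight j => exact Or.inr (Or.inl ⟨j, hd, rfl, Or.inl rfl⟩)
    | aLeft j =>
      have hj : j < k := hd
      refine Or.inr (Or.inl ⟨prev k j, ?_, rfl, Or.inr ?_⟩)
      · have := prev_spec k j
        omega
      · have := prev_spec k j
        have := aVertex_spec k (prev k j + 1)
        simp only [Dart.decode]
        omega
    | aRung j => exact Or.inl ⟨j, hd.1, hd.2, rfl, Or.inl rfl⟩
    | bRight j => exact Or.inr (Or.inr ⟨j, hd, rfl, Or.inl rfl⟩)
    | bLeft j =>
      obtain ⟨h₀, h₁⟩ : 0 < j ∧ j < k := hd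
      refine Or.inr (Or.inr ⟨j - 1, by omega, rfl, Or.inr ?_⟩)
      rw [show j - 1 + 1 = j by omega]
      rfl
    | bRung j =>
      obtain ⟨h₀, h₁⟩ : 0 < j ∧ j + 1 < k := hd
      refine Or.inl ⟨j, h₀, h₁, rfl, Or.inr ?_⟩
      have := bVertex_spec k j
      simp only [Dart.decode]
      omega

theorem rev_spec (hk : 3 ≤ k) (d : Dart) (hd : d.IsClosed k) :
    (d.rev k).IsClosed k ∧ ((d.rev k).decode k).2 = (d.decode k).2 ∧
      (cubicLadder k).IsLink (d.decode k).2 (d.decode k).1 ((d.rev k).decode k).1 := by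
  have ha : ∀ j, j < k → 2 * (if j + 1 = k then 0 else j + 1) = aVertex k (j + 1) := by
    intro j hj
    unfold aVertex
    split_ifs <;> omega
  cases d with
  | aRight j =>
    have hj : j < k := hd
    have hq : (if j + 1 = k then 0 else j + 1) < k := by split_ifs <;> omega
    refine ⟨hq, ?_, ?_⟩
    · change 3 * prev k (if j + 1 = k then 0 else j + 1) + 1 = 3 * j + 1
      have h : prev k (if j + 1 = k then 0 else j + 1) = j := by
        split_ifs with h
        · have := prev_spec k 0
          omega
        · have := prev_spec k (j + 1)
          omega
      rw [h]
    · change (cubicLadder k).IsLink (3 * j + 1) (2 * j) (2 * (if j + 1 = k then 0 else j + 1))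
      rw [ha j hj]
      exact isLink_a hk hj
  | aLeft j =>
    have hj : j < k := hd
    have h := prev_spec k j
    have hp : prev k j < k := by omega
    refine ⟨hp, rfl, ?_⟩
    have h₁ : 2 * j = aVertex k (prev k j + 1) := by
      have := aVertex_spec k (prev k j + 1)
      omega
    change (cubicLadder k).IsLink (3 * prev k j + 1) (2 * j) (2 * prev k j)
    rw [h₁]
    exact (isLink_a hk hp).symm
  | aRung j =>
    obtain ⟨h₀, h₁⟩ : 0 < j ∧ j + 1 < k := hd
    refine ⟨⟨h₀, h₁⟩, rfl, ?_⟩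
    have h : bVertex k j = 2 * j + 1 := by have := bVertex_spec k j; omega
    change (cubicLadder k).IsLink (3 * j) (2 * j) (bVertex k j)
    rw [h]
    exact isLink_rung h₀ h₁
  | bRight j =>
    have hj : j + 1 < k := hd
    exact ⟨⟨by omega, hj⟩, rfl, isLink_b hk hj⟩
  | bLeft j =>
    obtain ⟨h₀, h₁⟩ : 0 < j ∧ j < k := hd
    refine ⟨show j - 1 + 1 < k by omega, rfl, ?_⟩
    have h := isLink_b hk (show (j - 1) + 1 < k by omega)
    rw [show j - 1 + 1 = j by omega] at h
    exact h.symm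
  | bRung j =>
    obtain ⟨h₀, h₁⟩ : 0 < j ∧ j + 1 < k := hd
    refine ⟨⟨h₀, h₁⟩, rfl, ?_⟩
    have h : bVertex k j = 2 * j + 1 := by have := bVertex_spec k j; omega
    change (cubicLadder k).IsLink (3 * j) (bVertex k j) (2 * j)
    rw [h]
    exact (isLink_rung h₀ h₁).symm

/-- Every vertex other than `a_0` has a neighbour with a smaller number, which it reaches by an edge
other than the one between `a_(k-1)` and `a_0`. -/
theorem exists_adj_lt (hk : 3 ≤ k) {v : ℕ} (hv : v ∈ (cubicLadder k).vertexSet) (hne : v ≠ 0) :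
    ∃ u, (∃ e, (cubicLadder k).IsLink e v u ∧ e ≠ cubicLadderEdge k) ∧ u < v := by
  rw [mem_vertexSet_iff] at hv
  unfold cubicLadderEdge
  rcases Nat.mod_two_eq_zero_or_one v with h | h
  · obtain ⟨j, rfl⟩ : ∃ j, v = 2 * (j + 1) := ⟨v / 2 - 1, by omega⟩
    refine ⟨2 * j, ⟨3 * j + 1, ?_, by omega⟩, by omega⟩
    have h₁ := isLink_a hk (show j < k by omega)
    rw [show aVertex k (j + 1) = 2 * (j + 1) by have := aVertex_spec k (j + 1); omega] at h₁
    exact h₁.symm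
  · obtain ⟨j, rfl⟩ : ∃ j, v = 2 * j + 1 := ⟨v / 2, by omega⟩
    exact ⟨2 * j, ⟨3 * j, (isLink_rung (by omega) (by omega)).symm, by omega⟩, by omega⟩

/-- The circular orders of the planar drawing of the cubic ladder with all rungs upright. -/
def next (k : ℕ) : Dart → Dart
  | .aLeft j => if j = 0 then .bRight j else if j + 1 = k then .bLeft j else .aRung j
  | .aRung j => .aRight j
  | .aRight j => .aLeft j
  | .bLeft j => if j + 1 = k then .aRight j else .bRight j
  | .bRight j => if j = 0 then .aRight j else .bRung j
  | .bRung j => .bLeft j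

/-- The faces of the drawing `CubicLadder.next`: those between two rungs, the one along the
`b_j`, and the one along the `a_j`. -/
def face (k : ℕ) : Dart → ℕ
  | .aRight j => j
  | .aLeft _ => k
  | .aRung j => j - 1
  | .bRight _ => k - 1
  | .bLeft j => j - 1
  | .bRung j => j

theorem isPlanar (hk : 3 ≤ k) : (cubicLadder k).IsPlanar := by
  refine (exists_planeGraph (G := cubicLadder k) (N := k + 1) (root := 0)
    (finite_vertexSet k) (finite_edgeSet k) (loopless hk) (fun v => v)
    (fun v hv hne => ?_) (P := {d : Dart | d.IsClosed k}) (Dart.decode k) (injOn_decode hk)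
    (mem_darts_iff hk) (next k) (Dart.rev k) ?_ ?_
    (fun | .aLeft _ => 0 | .aRight _ => 1 | .aRung _ => 2 | .bRung _ => 1
         | .bRight _ => 2 | .bLeft j => if j + 1 = k then 2 else 0) ?_ ?_
    (rev_spec hk) (face k) ?_ ?_ ?_).imp fun H h => h.1
  · obtain ⟨u, ⟨e, he, -⟩, hu⟩ := exists_adj_lt hk hv hne
    exact ⟨u, ⟨e, he⟩, hu⟩
  · intro d hd
    cases d with | _ j =>
    all_goals
      have hb := bVertex_spec k j
      simp only [Set.mem_ofPred_eq, Dart.IsClosed] at hd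
      simp only [next]
      try split_ifs
      all_goals
        simp only [Set.mem_ofPred_eq, Dart.IsClosed, Dart.decode, and_true]
        omega
  · intro d hd d' hd' h
    cases d with | _ i =>
    all_goals
      cases d' with | _ j =>
      all_goals
        simp only [Set.mem_ofPred_eq, Dart.IsClosed] at hd hd'
        simp only [next] at h
        try split_ifs at h
        all_goals
          simp only [Dart.aLeft.injEq, Dart.aRight.injEq, Dart.aRung.injEq, Dart.bLeft.injEq,
            Dart.bRight.injEq, Dart.bRung.injEq, reduceCtorEq] at h ⊢
          try omega
  · intro d hd h₀
    cases d with | _ j =>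
    all_goals
      simp only [Set.mem_ofPred_eq, Dart.IsClosed] at hd
      simp only [next] at h₀ ⊢
      try split_ifs at h₀ ⊢
      all_goals
        try simp only
        try split_ifs
        all_goals omega
  · intro d hd d' hd' h h' hv
    cases d with | _ i =>
    all_goals
      cases d' with | _ j =>
      all_goals
        simp only [Set.mem_ofPred_eq, Dart.IsClosed] at hd hd'
        have h₁ := bVertex_spec k i
        have h₂ := bVertex_spec k j
        simp only [Dart.decode, Dart.aLeft.injEq, Dart.bLeft.injEq, reduceCtorEq] at h h' hv ⊢
        try split_ifs at h h'
        all_goals try omega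
  · intro d hd
    cases d with | _ j =>
    all_goals
      have hp := prev_spec k j
      simp only [Set.mem_ofPred_eq, Dart.IsClosed] at hd
      simp only [Dart.rev]
      try split_ifs
      all_goals
        simp only [next]
        try split_ifs
        all_goals
          simp only [face]
          all_goals first | omega | contradiction
  · intro q hq
    rcases Nat.lt_succ_iff_lt_or_eq.1 hq with h | h
    · exact ⟨.aRight q, h, rfl⟩
    · exact ⟨.aLeft 0, show 0 < k by omega, h.symm⟩
  · rw [ncard_vertexSet hk, ncard_edgeSet hk]
    omega

/-- The circular orders of the drawing of the cubic ladder without the edge between `a_(k-1)`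
and `a_0` in which every other rung is turned around. -/
def openNext (k : ℕ) : Dart → Dart
  | .aLeft j => if j + 1 = k then .bLeft j else if j % 2 = 0 then .aRung j else .aRight j
  | .aRung j => if j % 2 = 0 then .aRight j else .aLeft j
  | .aRight j => if j = 0 then .bRight j else if j % 2 = 0 then .aLeft j else .aRung j
  | .bLeft j => if j + 1 = k then .aLeft j else if j % 2 = 0 then .bRight j else .bRung j
  | .bRight j => if j = 0 then .aRight j else if j % 2 = 0 then .bRung j else .bLeft j
  | .bRung j => if j % 2 = 0 then .bLeft j else .bRight j

/-- The faces of the drawing `CubicLadder.openNext`.  Most of them are hexagons around two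
consecutive four-cycles of the ladder. -/
def openFace : Dart → ℕ
  | .aRight j => if j % 2 = 0 then j + 1 else j
  | .aLeft j => if j % 2 = 0 then j else j - 1
  | .aRung j => if j % 2 = 0 then j - 1 else j + 1
  | .bRight j => if j % 2 = 0 then j else j + 1
  | .bLeft j => if j % 2 = 0 then j - 1 else j
  | .bRung j => if j % 2 = 0 then j + 1 else j - 1

theorem isOpen_iff (hk : 3 ≤ k) (d : Dart) :
    d.IsOpen k ↔ d.IsClosed k ∧ (d.decode k).2 ≠ cubicLadderEdge k := by
  cases d with | _ j =>
  all_goals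
    have := prev_spec k j
    simp only [Dart.IsOpen, Dart.IsClosed, Dart.decode, cubicLadderEdge]
    omega

/-- The cubic ladder without the edge between `a_(k-1)` and `a_0` has a plane embedding in which
consecutive vertices `a_j` have opposite orientations. -/
theorem exists_open (hk : 3 ≤ k) :
    ∃ H : PlaneGraph ℕ ℕ, H.graph = (cubicLadder k).deleteEdges {cubicLadderEdge k} ∧
      ∀ d : Dart, d.IsOpen k → H.rot (d.decode k) = (openNext k d).decode k := by
  have hsub : {d : Dart | d.IsOpen k} ⊆ {d | d.IsClosed k} := fun d hd =>
    ((isOpen_iff hk d).1 hd).1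
  refine exists_planeGraph (G := (cubicLadder k).deleteEdges {cubicLadderEdge k}) (N := k)
    (root := 0) (finite_vertexSet k) ((finite_edgeSet k).subset fun e he => he.1)
    ⟨fun e x h => (loopless hk).not_isLoopAt e x h.1⟩ (fun v => v) (fun v hv hne => ?_)
    (P := {d : Dart | d.IsOpen k}) (Dart.decode k) ((injOn_decode hk).mono hsub) ?_ (openNext k)
    (Dart.rev k) ?_ ?_
    (fun | .aLeft _ => 0
         | .aRight j => if j = 0 then 0 else if j % 2 = 0 then 1 else 2
         | .aRung j => if j % 2 = 0 then 2 else 1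
         | .bLeft j => if j + 1 = k then 1 else 0
         | .bRight j => if j = 0 then 1 else if j % 2 = 0 then 2 else 1
         | .bRung j => if j % 2 = 0 then 1 else 2) ?_ ?_
    ?_ openFace ?_ ?_ ?_
  · obtain ⟨u, ⟨e, he, he'⟩, hu⟩ := exists_adj_lt hk hv hne
    exact ⟨u, ⟨e, he, he'⟩, hu⟩
  · intro d
    refine (Graph.deleteEdges_inc (G := cubicLadder k)).trans ?_
    constructor
    · rintro ⟨h₁, h₂⟩
      obtain ⟨p, hp, rfl⟩ := (mem_darts_iff hk d).1 h₁
      exact ⟨p, (isOpen_iff hk p).2 ⟨hp, h₂⟩, rfl⟩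
    · rintro ⟨p, hp, rfl⟩
      have h := (isOpen_iff hk p).1 hp
      exact ⟨(mem_darts_iff hk _).2 ⟨p, h.1, rfl⟩, h.2⟩
  · intro d hd
    cases d with | _ j =>
    all_goals
      have hb := bVertex_spec k j
      simp only [Set.mem_ofPred_eq, Dart.IsOpen] at hd
      simp only [openNext]
      try split_ifs
      all_goals
        simp only [Set.mem_ofPred_eq, Dart.IsOpen, Dart.decode, and_true]
        omega
  · intro d hd d' hd' h
    cases d with | _ i =>
    all_goals
      cases d' with | _ j =>
      all_goals
        simp only [Set.mem_ofPred_eq, Dart.IsOpen] at hd hd'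
        simp only [openNext] at h
        try split_ifs at h
        all_goals
          simp only [Dart.aLeft.injEq, Dart.aRight.injEq, Dart.aRung.injEq, Dart.bLeft.injEq,
            Dart.bRight.injEq, Dart.bRung.injEq, reduceCtorEq] at h ⊢
          try omega
  · intro d hd h₀
    cases d with | _ j =>
    all_goals
      simp only [Set.mem_ofPred_eq, Dart.IsOpen] at hd
      simp only [openNext] at h₀ ⊢
      try split_ifs at h₀ ⊢
      all_goals
        try simp only
        try split_ifs
        all_goals omega
  · intro d hd d' hd' h h' hv
    cases d with | _ i =>
    all_goals
      cases d' with | _ j =>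
      all_goals
        simp only [Set.mem_ofPred_eq, Dart.IsOpen] at hd hd'
        have h₁ := bVertex_spec k i
        have h₂ := bVertex_spec k j
        simp only [Dart.decode, Dart.aLeft.injEq, Dart.aRight.injEq, Dart.bLeft.injEq,
          reduceCtorEq] at h h' hv ⊢
        try split_ifs at h h'
        all_goals try omega
  · intro d hd
    have h := (isOpen_iff hk d).1 hd
    obtain ⟨h₁, h₂, h₃⟩ := rev_spec hk d h.1
    exact ⟨(isOpen_iff hk _).2 ⟨h₁, h₂ ▸ h.2⟩, h₂, h₃, h.2⟩
  · intro d hd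
    cases d with | _ j =>
    all_goals
      have hp := prev_spec k j
      simp only [Set.mem_ofPred_eq, Dart.IsOpen] at hd
      simp only [Dart.rev]
      try split_ifs
      all_goals
        simp only [openNext]
        try split_ifs
        all_goals
          simp only [openFace]
          try split_ifs
          all_goals omega
  · intro q hq
    rcases Nat.mod_two_eq_zero_or_one q with h | h
    · by_cases h₀ : q = 0
      · refine ⟨.bRight 0, show 0 + 1 < k by omega, ?_⟩
        simp [openFace, h₀]
      · refine ⟨.bRight (q - 1), show q - 1 + 1 < k by omega, ?_⟩
        simp only [openFace]
        rw [if_neg (by omega)]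
        omega
    · refine ⟨.aRight (q - 1), show q - 1 + 1 < k by omega, ?_⟩
      simp only [openFace]
      rw [if_pos (by omega)]
      omega
  · have h₁ : ((cubicLadder k).deleteEdges {cubicLadderEdge k}).edgeSet =
        (cubicLadder k).edgeSet \ {cubicLadderEdge k} := rfl
    have h₂ : cubicLadderEdge k ∈ (cubicLadder k).edgeSet := by
      rw [mem_edgeSet_iff, cubicLadderEdge]; omega
    rw [h₁, Set.ncard_sdiff_singleton_of_mem h₂, Graph.vertexSet_deleteEdges, ncard_vertexSet hk,
      ncard_edgeSet hk]
    omega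

theorem isTriad {j : ℕ} (hj : j + 2 < k) {H : PlaneGraph ℕ ℕ} (hH : H.graph = cubicLadder k) :
    H.IsTriad (2 * (j + 1)) (3 * j + 1) (3 * (j + 1)) (3 * (j + 1) + 1) :=
  ⟨by omega, by omega, by omega, fun e => by rw [hH]; exact inc_a_iff hj⟩

/-- In every embedding of a cubic ladder, the vertices `a_j` have the same orientation: all rungs
leave the cycle of the `a_j` on the side of the path of the `b_j`. -/
theorem sameOrientation {j : ℕ} (hj : j + 3 < k) {H : PlaneGraph ℕ ℕ}
    (hH : H.graph = cubicLadder k) :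
    H.SameOrientation (2 * (j + 1)) (2 * (j + 2)) (3 * j + 1) (3 * (j + 1)) (3 * (j + 1) + 1)
      (3 * (j + 2)) (3 * (j + 2) + 1) := by
  have hk : 3 ≤ k := by omega
  obtain ⟨side, hside⟩ := H.exists_sides {e | e % 3 = 1} (by
    intro v
    rw [hH]
    by_cases hv : v % 2 = 0 ∧ v < 2 * k
    · have h := prev_spec k (v / 2)
      have : {e | e ∈ {e | e % 3 = 1} ∧ (cubicLadder k).Inc e v} =
          {3 * (v / 2) + 1, 3 * prev k (v / 2) + 1} := by
        ext e
        simp only [Set.mem_ofPred_eq, Set.mem_insert_iff, Set.mem_singleton_iff, inc_iff hk]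
        constructor
        · rintro ⟨he, ⟨i, hi⟩ | ⟨i, hi⟩ | ⟨i, hi⟩⟩
          · omega
          · have := aVertex_spec k (i + 1)
            omega
          · omega
        · rintro (rfl | rfl)
          · exact ⟨by omega, Or.inr (Or.inl ⟨v / 2, by omega⟩)⟩
          · have := aVertex_spec k (prev k (v / 2) + 1)
            exact ⟨by omega, Or.inr (Or.inl ⟨prev k (v / 2), by omega⟩)⟩
      rw [this, Set.ncard_pair (by omega)]
      exact even_two
    · refine even_ncard_of_forall_notMem fun e he => hv ?_
      simp only [Set.mem_ofPred_eq, inc_iff hk] at he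
      obtain ⟨he, ⟨i, hi⟩ | ⟨i, hi⟩ | ⟨i, hi⟩⟩ := he
      · omega
      · have := aVertex_spec k (i + 1)
        omega
      · omega)
  have hmem : ∀ {e : ℕ}, e % 3 ≠ 1 → e ∉ {e | e % 3 = 1} := fun h => h
  have hrung : ∀ {i}, 0 < i → i + 1 < k →
      ((2 * i, 3 * i) ∈ side ↔ (2 * i + 1, 3 * i) ∈ side) := by
    intro i h₀ h₁
    have h : H.graph.IsLink (3 * i) (2 * i) (2 * i + 1) := hH ▸ isLink_rung h₀ h₁
    rw [(hside _ _ _ h).2, iff_true_right (hmem (by omega))]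
  -- No edge at `b_i` belongs to the cycle, so all darts at `b_i` are on the same side.
  have hb : ∀ {i e e'}, i + 2 < k → (cubicLadder k).Inc e (2 * (i + 1) + 1) →
      (cubicLadder k).Inc e' (2 * (i + 1) + 1) →
      ((2 * (i + 1) + 1, e) ∈ side ↔ (2 * (i + 1) + 1, e') ∈ side) := by
    intro i e e' hi he he'
    refine iff_of_eq (Graph.eq_of_rot_invariant H.finite_vertexSet H.finite_edgeSet
      H.rot_isCycleOn (fun d => d ∈ side) ?_ (hH ▸ he) (hH ▸ he'))
    rintro e ⟨w, h⟩
    have h' : e % 3 ≠ 1 := by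
      have := (inc_b_iff hi).1 (hH ▸ h.inc_left)
      omega
    refine propext ?_
    rw [(hside _ _ _ h).1, (hside _ _ _ h).2, iff_true_right (hmem h')]
  have hlink : H.graph.IsLink (3 * (j + 1) + 2) (2 * (j + 1) + 1) (2 * (j + 2) + 1) := by
    have h₁ := bVertex_spec k (j + 1)
    have h₂ := bVertex_spec k (j + 1 + 1)
    have h := isLink_b hk (show j + 1 + 1 < k by omega)
    rw [show bVertex k (j + 1) = 2 * (j + 1) + 1 by omega,
      show bVertex k (j + 1 + 1) = 2 * (j + 2) + 1 by omega] at h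
    exact hH ▸ h
  have hlink_a : H.graph.IsLink (3 * (j + 1) + 1) (2 * (j + 1)) (2 * (j + 2)) := by
    have h₂ := aVertex_spec k (j + 1 + 1)
    have h := isLink_a hk (show j + 1 < k by omega)
    rw [show aVertex k (j + 1 + 1) = 2 * (j + 2) by omega] at h
    exact hH ▸ h
  refine PlaneGraph.sameOrientation_of_sides hside (isTriad (by omega) hH)
    (isTriad (j := j + 1) (by omega) hH) hlink_a (show (3 * (j + 1) + 1) % 3 = 1 by omega)
    (hmem (by omega)) (hmem (by omega)) ?_
  rw [hrung (i := j + 1) (by omega) (by omega), hrung (i := j + 2) (by omega) (by omega),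
    hb (e' := 3 * (j + 1) + 2) (by omega) ((inc_b_iff (by omega)).2 (by omega))
      ((inc_b_iff (by omega)).2 (by omega)),
    hb (i := j + 1) (e' := 3 * (j + 1) + 2) (by omega) ((inc_b_iff (by omega)).2 (by omega))
      ((inc_b_iff (by omega)).2 (by omega)),
    (hside _ _ _ hlink).2, iff_true_right (hmem (by omega))]

/-- The flip-distance for the cubic ladder. -/
theorem le_mul_flipDist (hk : 3 ≤ k) :
    ((2 * k - 2 : ℕ) : ℕ∞) ≤ (12 : ℕ) *
      flipDist (Emb ((cubicLadder k).deleteEdges {cubicLadderEdge k})) (Emb (cubicLadder k)) := by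
  obtain ⟨H, hH, hrot⟩ := exists_open hk
  have hE : cubicLadderEdge k ∈ (cubicLadder k).edgeSet := by
    rw [mem_edgeSet_iff, cubicLadderEdge]; omega
  refine PlaneGraph.le_mul_flipDist (N := k - 3) (H := H) hH ?_
    (v := fun j => 2 * (j + 1)) ?_ (fun j => 3 * j + 1) (fun j => 3 * (j + 1))
    (fun j => 3 * (j + 1) + 1) (fun j => 3 * (j + 2)) (fun j => 3 * (j + 2) + 1) ?_ ?_ ?_
  · intro h
    have h' : cubicLadderEdge k ∈ H.graph.edgeSet := by
      rw [show H.graph = cubicLadder k from h]; exact hE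
    rw [hH] at h'
    exact h'.2 rfl
  · intro p _ q _ h
    simp only at h
    omega
  · rintro j hj ⟨-, -, h⟩
    have h₁ := hrot (.aLeft (j + 1)) ⟨by omega, by omega⟩
    have h₂ := hrot (.aLeft (j + 2)) ⟨by omega, by omega⟩
    have p₁ : prev k (j + 1) = j := by have := prev_spec k (j + 1); omega
    have p₂ : prev k (j + 2) = j + 1 := by have := prev_spec k (j + 2); omega
    simp only [Dart.decode, p₁, p₂] at h₁ h₂
    rw [h₁, h₂] at h
    rcases Nat.mod_two_eq_zero_or_one j with h₀ | h₀
    · have h₃ : openNext k (.aLeft (j + 1)) = .aRight (j + 1) := by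
        simp only [openNext]; rw [if_neg (by omega), if_neg (by omega)]
      have h₄ : openNext k (.aLeft (j + 2)) = .aRung (j + 2) := by
        simp only [openNext]; rw [if_neg (by omega), if_pos (by omega)]
      rw [h₃, h₄] at h
      have := (Prod.ext_iff.1 (h.2 rfl)).2
      simp only at this
      omega
    · have h₃ : openNext k (.aLeft (j + 1)) = .aRung (j + 1) := by
        simp only [openNext]; rw [if_neg (by omega), if_pos (by omega)]
      have h₄ : openNext k (.aLeft (j + 2)) = .aRight (j + 2) := by
        simp only [openNext]; rw [if_neg (by omega), if_neg (by omega)]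
      rw [h₃, h₄] at h
      have := (Prod.ext_iff.1 (h.1 rfl)).2
      simp only at this
      omega
  · intro H' hH' j hj
    exact sameOrientation (by omega) hH'
  · intro m hm hmN
    omega

end CubicLadder

/-! ### Lower bounds for both families -/

theorem mainTheorem5 :
    (∃ C K : ℕ, ∀ n : ℕ, 1 ≤ n → ∃ (G : Graph ℕ ℕ) (e : ℕ),
      G.IsPlanar ∧ G.vertexSet.ncard ≤ C * n ∧ e ∈ G.edgeSet ∧
        (n : ℕ∞) ≤ K * flipDist (Emb (G.deleteEdges {e})) (Emb G)) ∧
    (∃ K : ℕ, ∀ n : ℕ, 5 ≤ n →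
      (wheel n).IsPlanar ∧ (wheel n).vertexSet.ncard = n ∧
        ∀ i < n - 1, 2 * i + 1 ∈ (wheel n).edgeSet ∧
          (n : ℕ∞) ≤ K * flipDist (Emb ((wheel n).deleteEdges {2 * i + 1})) (Emb (wheel n))) ∧
    (∃ K : ℕ, ∀ k : ℕ, 3 ≤ k →
      (cubicLadder k).IsPlanar ∧ (cubicLadder k).vertexSet.ncard = 2 * k - 2 ∧
        (∀ v ∈ (cubicLadder k).vertexSet, {e | (cubicLadder k).Inc e v}.ncard = 3) ∧
        cubicLadderEdge k ∈ (cubicLadder k).edgeSet ∧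
        ((2 * k - 2 : ℕ) : ℕ∞) ≤
          K * flipDist (Emb ((cubicLadder k).deleteEdges {cubicLadderEdge k}))
            (Emb (cubicLadder k))) := by
  have hwheel : ∀ n : ℕ, 5 ≤ n →
      (wheel n).IsPlanar ∧ (wheel n).vertexSet.ncard = n ∧
        ∀ i < n - 1, 2 * i + 1 ∈ (wheel n).edgeSet ∧ (n : ℕ∞) ≤ (8 : ℕ) *
          flipDist (Emb ((wheel n).deleteEdges {2 * i + 1})) (Emb (wheel n)) := by
    intro n hn
    obtain ⟨M, rfl⟩ : ∃ M, n = M + 1 := ⟨n - 1, by omega⟩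
    refine ⟨Wheel.isPlanar (by omega), ncard_lt_nat _, fun i hi => ⟨?_, ?_⟩⟩
    · change 2 * i + 1 < 2 * (M + 1 - 1)
      omega
    · exact Wheel.le_mul_flipDist (by omega) hi
  refine ⟨⟨5, 8, fun n hn => ?_⟩, ⟨8, hwheel⟩, ⟨12, fun k hk => ?_⟩⟩
  · -- The smallest wheel to which the bound applies has five vertices.
    obtain ⟨h₁, h₂, h₃⟩ := hwheel (n + 4) (by omega)
    obtain ⟨h₄, h₅⟩ := h₃ 0 (by omega)
    refine ⟨wheel (n + 4), 2 * 0 + 1, h₁, by omega, h₄, le_trans ?_ h₅⟩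
    exact Nat.cast_le.2 (by omega)
  · exact ⟨CubicLadder.isPlanar hk, CubicLadder.ncard_vertexSet hk, fun v => CubicLadder.cubic hk,
      by rw [CubicLadder.mem_edgeSet_iff, cubicLadderEdge]; omega,
      CubicLadder.le_mul_flipDist hk⟩
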